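/- Let $R$ be a commutative ring with unity such that $R=2R$, let $I$ be an ideal of $R$, let $n\ge 2$, and let $\varphi\in M_{2n}(R)$ be a skew-symmetric matrix ($\varphi^t=-\varphi$) of Pfaffian $1$. For a ring homomorphism $R\to S$, $\varphi$ also denotes its image over $S$. Put $\mathrm{Sp}_\varphi(S)=\{\alpha\in\mathrm{GL}_{2n}(S) : \alpha^t\varphi\alpha=\varphi\}$. Write $\varphi=\begin{pmatrix}0&-c^t\\ c&\nu\end{pmatrix}$ and $\varphi^{-1}=\begin{pmatrix}0&d^t\\ -d&\mu\end{pmatrix}$ with $c,d\in S^{2n-1}$ and $\nu,\mu\in M_{2n-1}(S)$, and for $v\in S^{2n-1}$ put $$C_\varphi(v)=\begin{pmatrix}1&0\\ v&I_{2n-1}+dv^t\nu\end{pmatrix},\qquad R_\varphi(v)=\begin{pmatrix}1&v^t\\ 0&I_{2n-1}+\mu vc^t\end{pmatrix}.$$ Let $\mathrm{ESp}_\varphi(S)$ be the subgroup of $\mathrm{GL}_{2n}(S)$ generated by all $C_\varphi(v)$ and $R_\varphi(v)$ with $v\in S^{2n-1}$. For an ideal $J$ of $S$ let $\mathrm{ESp}_\varphi(S,J)$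 be the normal closure in $\mathrm{ESp}_\varphi(S)$ of the subgroup generated by all $C_\varphi(v)$ and $R_\varphi(v)$ with $v\in J^{2n-1}$. Local-Global principle: let $\theta(X)\in\mathrm{Sp}_\varphi(R[X])$ with $\theta(0)=I_{2n}$. For a maximal ideal $\mathfrak m$ of $R$, let $I_{\mathfrak m}=IR_{\mathfrak m}$ and let $\theta(X)_{\mathfrak m}$ be the image of $\theta(X)$ in $\mathrm{GL}_{2n}(R_{\mathfrak m}[X])$. If $\theta(X)_{\mathfrak m}\in\mathrm{ESp}_\varphi(R_{\mathfrak m}[X],I_{\mathfrak m}[X])$ for all maximal ideals $\mathfrak m$ of $R$, then $\theta(X)\in\mathrm{ESp}_\varphi(R[X],I[X])$. -/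

import Mathlib

open Matrix Polynomial

/-- The Pfaffian of a square matrix, by expansion along the first row:
`Pf(A) = ∑_j (-1)^j a_{0,j+1} Pf(A_j)`, where `A_j` is `A` without the rows and columns
`0` and `j+1`. It is `1` for the empty matrix and `0` in odd size. -/
def pfaffian {R : Type*} [CommRing R] : (k : ℕ) → Matrix (Fin k) (Fin k) R → R
  | 0, _ => 1
  | 1, _ => 0
  | k + 2, A => ∑ j : Fin (k + 1), (-1) ^ (j : ℕ) * A 0 j.succ *
      pfaffian k (A.submatrix (fun i => (j.succAbove i).succ) (fun i => (j.succAbove i).succ))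

/-- `Sp_φ(R) = {α ∈ GL(R) | αᵗ φ α = φ}`. -/
def symplecticGroupOf {R : Type*} [CommRing R] {k : ℕ} (φ : Matrix (Fin k) (Fin k) R) :
    Subgroup (GL (Fin k) R) where
  carrier := {α | (α : Matrix (Fin k) (Fin k) R)ᵀ * φ * (α : Matrix (Fin k) (Fin k) R) = φ}
  one_mem' := by simp
  mul_mem' := by
    intro a b ha hb
    simp only [Set.mem_ofPred_eq, Units.val_mul, Matrix.transpose_mul] at *
    calc _ = (b : Matrix (Fin k) (Fin k) R)ᵀ *
          ((a : Matrix (Fin k) (Fin k) R)ᵀ * φ * (a : Matrix (Fin k) (Fin k) R)) *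
          (b : Matrix (Fin k) (Fin k) R) := by simp only [Matrix.mul_assoc]
      _ = φ := by rw [ha, hb]
  inv_mem' := by
    intro a ha
    simp only [Set.mem_ofPred_eq] at *
    have h : (a : Matrix (Fin k) (Fin k) R) * ((a⁻¹ : GL (Fin k) R) : Matrix (Fin k) (Fin k) R)
        = 1 := Units.mul_inv a
    have ht := congrArg Matrix.transpose h
    rw [Matrix.transpose_mul, Matrix.transpose_one] at ht
    calc _ = ((a⁻¹ : GL (Fin k) R) : Matrix (Fin k) (Fin k) R)ᵀ *
          ((a : Matrix (Fin k) (Fin k) R)ᵀ * φ * (a : Matrix (Fin k) (Fin k) R)) *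
          ((a⁻¹ : GL (Fin k) R) : Matrix (Fin k) (Fin k) R) := by rw [ha]
      _ = (((a⁻¹ : GL (Fin k) R) : Matrix (Fin k) (Fin k) R)ᵀ *
          (a : Matrix (Fin k) (Fin k) R)ᵀ) * φ * ((a : Matrix (Fin k) (Fin k) R) *
          ((a⁻¹ : GL (Fin k) R) : Matrix (Fin k) (Fin k) R)) := by simp only [Matrix.mul_assoc]
      _ = φ := by rw [h, ht, Matrix.one_mul, Matrix.mul_one]

section Vaserstein

variable {R : Type*} [CommRing R] {m : ℕ}

/-- With `φ = (0, -cᵗ; c, ν)` and `φ⁻¹ = (0, dᵗ; -d, μ)` in blocks of sizes `1` and `m`,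
this is `α_φ(v) = I + d vᵗ ν`. -/
noncomputable def vasersteinAlpha (φ : Matrix (Fin (m + 1)) (Fin (m + 1)) R) (v : Fin m → R) :
    Matrix (Fin m) (Fin m) R :=
  1 + vecMulVec (fun i => φ⁻¹ 0 i.succ) v * φ.submatrix Fin.succ Fin.succ

/-- In the same notation, `β_φ(v) = I + μ v cᵗ`. -/
noncomputable def vasersteinBeta (φ : Matrix (Fin (m + 1)) (Fin (m + 1)) R) (v : Fin m → R) :
    Matrix (Fin m) (Fin m) R :=
  1 + φ⁻¹.submatrix Fin.succ Fin.succ * vecMulVec v (fun i => φ i.succ 0)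

/-- The block matrix `C_φ(v) = (1, 0; v, α_φ(v))`. -/
noncomputable def vasersteinC (φ : Matrix (Fin (m + 1)) (Fin (m + 1)) R) (v : Fin m → R) :
    Matrix (Fin (m + 1)) (Fin (m + 1)) R :=
  Matrix.of (Fin.cons (Fin.cons 1 0) (fun i => Fin.cons (v i) (vasersteinAlpha φ v i)))

/-- The block matrix `R_φ(v) = (1, vᵗ; 0, β_φ(v))`. -/
noncomputable def vasersteinR (φ : Matrix (Fin (m + 1)) (Fin (m + 1)) R) (v : Fin m → R) :
    Matrix (Fin (m + 1)) (Fin (m + 1)) R :=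
  Matrix.of (Fin.cons (Fin.cons 1 v) (fun i => Fin.cons 0 (vasersteinBeta φ v i)))

/-- `ESp_φ(R)`: the group generated by all `C_φ(v)` and `R_φ(v)`
(which are invertible matrices when `φ` is invertible and alternating). -/
def elemSymplectic (φ : Matrix (Fin (m + 1)) (Fin (m + 1)) R) : Subgroup (GL (Fin (m + 1)) R) :=
  Subgroup.closure {g | ∃ v : Fin m → R,
    (g : Matrix (Fin (m + 1)) (Fin (m + 1)) R) = vasersteinC φ v ∨
    (g : Matrix (Fin (m + 1)) (Fin (m + 1)) R) = vasersteinR φ v}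

/-- `ESp_φ(I)`: the group generated by the `C_φ(v)` and `R_φ(v)` with all entries of `v` in `I`. -/
def elemSymplecticIdeal (φ : Matrix (Fin (m + 1)) (Fin (m + 1)) R) (I : Ideal R) :
    Subgroup (GL (Fin (m + 1)) R) :=
  Subgroup.closure {g | ∃ v : Fin m → R, (∀ i, v i ∈ I) ∧
    ((g : Matrix (Fin (m + 1)) (Fin (m + 1)) R) = vasersteinC φ v ∨
     (g : Matrix (Fin (m + 1)) (Fin (m + 1)) R) = vasersteinR φ v)}

/-- `ESp_φ(R, I)`: the normal closure of `ESp_φ(I)` in `ESp_φ(R)`, as a subgroup of `GL(R)`. -/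
def relElemSymplectic (φ : Matrix (Fin (m + 1)) (Fin (m + 1)) R) (I : Ideal R) :
    Subgroup (GL (Fin (m + 1)) R) :=
  (Subgroup.normalClosure
    (((elemSymplecticIdeal φ I).subgroupOf (elemSymplectic φ) : Subgroup (elemSymplectic φ)) :
      Set (elemSymplectic φ))).map (elemSymplectic φ).subtype

end Vaserstein

/-! The matrices `C_φ(v)` and `R_φ(v)` act as Eichler transformations of the alternating form `φ`.
Their axes are row `0` of `φ⁻¹` (called `w`) and the first basis vector `e`, and `(e, w)` is a
hyperbolic pair (`toLin'_vaserstein`, `hyperbolic`). This needs `φ` invertible, which follows from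
Pfaffian `1` (`isUnit_det_of_pfaffian`).

The algebraic core is absorption (`absorbs_of_mem`, `exists_conj_mem`). For each elementary `γ`
there is `N` such that, for every `t`, conjugation by `γ` sends products of generators with
parameter divisible by `t ^ N` to products of generators with parameter divisible by `t`. The proof
needs a second hyperbolic pair orthogonal to `e` and `w`. Over a local ring one exists by a rank
count.

The relative group is reduced to the absolute one over the ring of pairs congruent modulo `J`: a
relative element lifts to an elementary element whose first component is `1` (`exists_pair_lift`).
If moreover it is `1` at `X = 0`, it is a product of conjugates, by constant elements, of generators
divisible by `X`. After `X ↦ X ^ n` with `n` large, absorption removes the conjugations. A further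
`X ↦ sX` clears denominators, and evaluating at a suitable element kills the torsion that remains.
This is the dilation principle `exists_eval_mem`.

Dilation applied to `θ(X + YT) θ(X)⁻¹`, with `T` the new variable, gives for each maximal ideal some
`s` outside it with `θ(X + sY) θ(X)⁻¹` relatively elementary. Such `s` form an ideal, hence `s = 1`
is allowed, and `X ↦ 0`, `Y ↦ X` gives `θ` (Quillen patching). -/

section Eichler

/-! ### Eichler transformations of an alternating form and their absorption under conjugation. -/

variable {S P : Type*} [CommRing S] [AddCommGroup P] [Module S P]

/-- The Eichler transformation `v ↦ v + ⟨u, v⟩ x + ⟨x, v⟩ u`. -/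
def eichler (B : LinearMap.BilinForm S P) (x u : P) : Module.End S P :=
  1 + (B u).smulRight x + (B x).smulRight u

/-- The transvection `v ↦ v + c ⟨x, v⟩ x`. -/
def transvec (B : LinearMap.BilinForm S P) (x : P) (c : S) : Module.End S P :=
  1 + c • (B x).smulRight x

@[simp] theorem eichler_apply (B : LinearMap.BilinForm S P) (x u v : P) :
    eichler B x u v = v + B u v • x + B x v • u := rfl

@[simp] theorem transvec_apply (B : LinearMap.BilinForm S P) (x v : P) (c : S) :
    transvec B x c v = v + c • B x v • x := rfl

/-- The monoid generated by the Eichler transformations along `e` and `w` with parameter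
divisible by `t`. -/
def eichlerMonoid (B : LinearMap.BilinForm S P) (e w : P) (t : S) : Submonoid (Module.End S P) :=
  Submonoid.closure ({f | ∃ u, B e u = 0 ∧ f = eichler B e (t • u)} ∪
    {f | ∃ u, B w u = 0 ∧ f = eichler B w (t • u)})

variable {B : LinearMap.BilinForm S P} {e w : P} {t : S}

theorem eichler_left_mem {u : P} (hu : B e u = 0) :
    eichler B e (t • u) ∈ eichlerMonoid B e w t :=
  Submonoid.subset_closure (Or.inl ⟨u, hu, rfl⟩)

theorem eichler_right_mem {u : P} (hu : B w u = 0) :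
    eichler B w (t • u) ∈ eichlerMonoid B e w t :=
  Submonoid.subset_closure (Or.inr ⟨u, hu, rfl⟩)

/-- The rotation `(e, w) ↦ (w, -e)` preserves hyperbolic pairs, so results about the axis `e`
transfer to the axis `w`. -/
theorem eichlerMonoid_swap (B : LinearMap.BilinForm S P) (e w : P) (t : S) :
    eichlerMonoid B w (-e) t = eichlerMonoid B e w t := by
  have key : ∀ u, eichler B (-e) (t • -u) = eichler B e (t • u) := by
    intro u; ext v; simp
  apply le_antisymm <;> refine Submonoid.closure_le.2 ?_
  · rintro _ (⟨u, hu, rfl⟩ | ⟨u, hu, rfl⟩)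
    · exact eichler_right_mem hu
    · have := key (-u)
      rw [neg_neg] at this
      rw [this]
      exact eichler_left_mem (by simpa using hu)
  · rintro _ (⟨u, hu, rfl⟩ | ⟨u, hu, rfl⟩)
    · rw [← key]; exact eichler_right_mem (by simpa using hu)
    · exact eichler_left_mem hu

theorem eichler_mul_neg (hB : B.IsAlt) {x u : P} (h : B x u = 0) :
    eichler B x u * eichler B x (-u) = 1 := by
  have h' : B u x = 0 := by rw [← hB.neg_eq, h, neg_zero]
  ext v
  simp only [Module.End.mul_apply, Module.End.one_apply, eichler_apply, map_add, map_smul, map_neg,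
    LinearMap.neg_apply, h, h', hB.self_eq_zero]
  module

theorem eichler_neg_mul (hB : B.IsAlt) {x u : P} (h : B x u = 0) :
    eichler B x (-u) * eichler B x u = 1 := by
  have := eichler_mul_neg (x := x) (u := -u) hB (by simp [h])
  rwa [neg_neg] at this

theorem eichler_isometry (hB : B.IsAlt) {x u : P} (h : B x u = 0) (y z : P) :
    B (eichler B x u y) (eichler B x u z) = B y z := by
  have h' : B u x = 0 := by rw [← hB.neg_eq, h, neg_zero]
  simp only [eichler_apply, map_add, map_smul, LinearMap.add_apply, LinearMap.smul_apply,
    smul_eq_mul, h, h', hB.self_eq_zero]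
  rw [← hB.neg_eq y x, ← hB.neg_eq y u]
  ring

/-- Absorption thereby becomes the task of factoring Eichler transformations along the moved axis `g
x`. -/
theorem conj_eichler {g g' : Module.End S P} (hg : ∀ y z, B (g y) (g z) = B y z)
    (hgg : g * g' = 1) (x u : P) : g * eichler B x u * g' = eichler B (g x) (g u) := by
  have h1 : ∀ v, g (g' v) = v := fun v => by rw [← Module.End.mul_apply, hgg]; rfl
  have h2 : ∀ y v, B y (g' v) = B (g y) v := fun y v => by rw [← hg, h1]
  ext v
  simp [h1, h2]

/-- Conjugation by `g`, with inverse `g'`, moves sufficiently divisible Eichler generators into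
the monoid of divisible ones. -/
def EichlerAbsorbs (B : LinearMap.BilinForm S P) (e w : P) (g g' : Module.End S P) : Prop :=
  g * g' = 1 ∧ g' * g = 1 ∧
    ∃ N : ℕ, ∀ t f, f ∈ eichlerMonoid B e w (t ^ N) → g * f * g' ∈ eichlerMonoid B e w t

/-- The exponent does not depend on `t`, so the property of `k` may be used at `t ^ N`, and the
exponents multiply. -/
theorem EichlerAbsorbs.mul {g g' k k' : Module.End S P} (hg : EichlerAbsorbs B e w g g')
    (hk : EichlerAbsorbs B e w k k') : EichlerAbsorbs B e w (g * k) (k' * g') := by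
  obtain ⟨h1, h2, N, hN⟩ := hg
  obtain ⟨k1, k2, K, hK⟩ := hk
  refine ⟨?_, ?_, N * K, fun t f hf => ?_⟩
  · rw [mul_assoc, ← mul_assoc k, k1, one_mul, h1]
  · rw [mul_assoc, ← mul_assoc g', h2, one_mul, k2]
  · have := hN t _ (hK (t ^ N) f (by rwa [← pow_mul]))
    simpa only [mul_assoc] using this

theorem absorbs_of_generators {g g' : Module.End S P} (h1 : g * g' = 1) (h2 : g' * g = 1) (N : ℕ)
    (he : ∀ (t : S) u, B e u = 0 → g * eichler B e (t ^ N • u) * g' ∈ eichlerMonoid B e w t)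
    (hw : ∀ (t : S) u, B w u = 0 → g * eichler B w (t ^ N • u) * g' ∈ eichlerMonoid B e w t) :
    EichlerAbsorbs B e w g g' := by
  refine ⟨h1, h2, N, fun t f hf => ?_⟩
  induction hf using Submonoid.closure_induction with
  | mem x hx =>
    rcases hx with ⟨u, hu, rfl⟩ | ⟨u, hu, rfl⟩
    · exact he t u hu
    · exact hw t u hu
  | one => rw [mul_one, h1]; exact one_mem _
  | mul x y _ _ hx hy =>
    have : g * (x * y) * g' = (g * x * g') * (g * y * g') := by
      calc _ = g * x * 1 * y * g' := by simp only [mul_assoc, mul_one]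
        _ = _ := by rw [← h2]; simp only [mul_assoc]
    rw [this]
    exact mul_mem hx hy

theorem EichlerAbsorbs.swap {g g' : Module.End S P} (h : EichlerAbsorbs B w (-e) g g') :
    EichlerAbsorbs B e w g g' := by
  simpa only [EichlerAbsorbs, eichlerMonoid_swap] using h

/-- `(e, w)` is a hyperbolic pair for the alternating form `B`. -/
structure IsHyperbolicPair (B : LinearMap.BilinForm S P) (e w : P) : Prop where
  alt : B.IsAlt
  right_left : B w e = 1

namespace IsHyperbolicPair

variable (H : IsHyperbolicPair B e w)
include H

theorem left_right : B e w = -1 := by rw [← H.alt.neg_eq, H.right_left]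

theorem left_left : B e e = 0 := H.alt.self_eq_zero e

theorem right_right : B w w = 0 := H.alt.self_eq_zero w

theorem swap : IsHyperbolicPair B w (-e) :=
  ⟨H.alt, by simp [H.left_right]⟩

end IsHyperbolicPair

/-- Transformations with a common axis form a Heisenberg-type group whose central elements are the
transvections along that axis. -/
theorem eichler_add (hB : B.IsAlt) {x u u' : P} (hu : B x u = 0) (hu' : B x u' = 0) :
    eichler B x (u + u') = eichler B x u * eichler B x u' * transvec B x (-B u u') := by
  have h1 : B u x = 0 := by rw [← hB.neg_eq, hu, neg_zero]
  have h2 : B u' x = 0 := by rw [← hB.neg_eq, hu', neg_zero]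
  ext v
  simp only [Module.End.mul_apply, eichler_apply, transvec_apply, map_add, map_smul,
    LinearMap.add_apply, hu', h1, h2, hB.self_eq_zero]
  module

/-- Once `2` is invertible, the central transvection is itself a shift of the direction by a
multiple of the axis. -/
theorem eichler_mul_eichler' (hB : B.IsAlt) {h : S} (hh : 2 * h = 1) {x u u' : P}
    (hu : B x u = 0) (hu' : B x u' = 0) :
    eichler B x u * eichler B x u' = eichler B x (u + u' + (h * B u u') • x) := by
  have h1 : B u x = 0 := by rw [← hB.neg_eq, hu, neg_zero]
  ext v
  have h3 : B u u' = 2 * (h * B u u') := by rw [← mul_assoc, hh, one_mul]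
  simp only [Module.End.mul_apply, eichler_apply, map_add, map_smul,
    LinearMap.add_apply, LinearMap.smul_apply, smul_eq_mul, hu', h1, hB.self_eq_zero]
  generalize h * B u u' = d at h3 ⊢
  rw [h3]
  module

theorem eichler_smul_self_add (hB : B.IsAlt) {x r : P} (hr : B x r = 0) (a : S) :
    eichler B x (a • x + r) = eichler B x r * transvec B x (2 * a) := by
  have h1 : B r x = 0 := by rw [← hB.neg_eq, hr, neg_zero]
  ext v
  simp only [Module.End.mul_apply, eichler_apply, transvec_apply, map_add, map_smul,
    LinearMap.add_apply, LinearMap.smul_apply, smul_eq_mul, h1, hB.self_eq_zero]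
  module

theorem transvec_eq_eichler {h : S} (hh : 2 * h = 1) (x : P) (s c : S) :
    transvec B x (s * c) = eichler B x (s • (h * c) • x) := by
  ext v
  have h3 : c = 2 * (h * c) := by rw [← mul_assoc, hh, one_mul]
  simp only [transvec_apply, eichler_apply, map_smul, LinearMap.smul_apply, smul_eq_mul]
  nth_rw 1 [h3]
  module

/-- The Heisenberg commutator of two directions pairing to `1`: each factor needs only one `t`, and
the parameter of the result is divisible by `t * t`. -/
theorem transvec_eq_commutator (hB : B.IsAlt) {x q q' : P} (hq : B x q = 0) (hq' : B x q' = 0)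
    (hqq : B q q' = 1) (t d : S) : transvec B x (t * t * (d + d)) =
      eichler B x (t • q) * eichler B x (t • d • q') *
      eichler B x (t • -q) * eichler B x (t • -(d • q')) := by
  have h1 : B q x = 0 := by rw [← hB.neg_eq, hq, neg_zero]
  have h2 : B q' x = 0 := by rw [← hB.neg_eq, hq', neg_zero]
  have h5 : B q' q = -1 := by rw [← hB.neg_eq, hqq]
  ext v
  simp only [Module.End.mul_apply, eichler_apply, transvec_apply, map_add, map_smul, map_neg,
    LinearMap.neg_apply, smul_neg, LinearMap.smul_apply, smul_eq_mul, h1, h2, h5, hqq, hq, hq',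
    hB.self_eq_zero]
  module

namespace IsHyperbolicPair

variable (H : IsHyperbolicPair B e w) {h : S} (hh : 2 * h = 1)
include H hh

theorem transvec_left_mem (c : S) : transvec B e (t * c) ∈ eichlerMonoid B e w t := by
  rw [transvec_eq_eichler hh]
  exact eichler_left_mem (by simp [H.left_left])

theorem transvec_right_mem (c : S) : transvec B w (t * c) ∈ eichlerMonoid B e w t := by
  rw [transvec_eq_eichler hh]
  exact eichler_right_mem (by simp [H.right_right])

omit hh in
-- A commutator of one generator along `w` and one along `e`, each contributing one factor `t`.
theorem eichler_levi_mem {q q' : P} (hq : B e q = 0 ∧ B w q = 0) (hq' : B e q' = 0 ∧ B w q' = 0)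
    (hqq : B q q' = 0) : eichler B q ((t * t) • q') ∈ eichlerMonoid B e w t := by
  have h1 : B q e = 0 := by rw [← H.alt.neg_eq, hq.1, neg_zero]
  have h2 : B q w = 0 := by rw [← H.alt.neg_eq, hq.2, neg_zero]
  have h3 : B q' e = 0 := by rw [← H.alt.neg_eq, hq'.1, neg_zero]
  have h4 : B q' w = 0 := by rw [← H.alt.neg_eq, hq'.2, neg_zero]
  have h5 : B q' q = 0 := by rw [← H.alt.neg_eq, hqq, neg_zero]
  have : eichler B q ((t * t) • q') = eichler B w (t • q') * (eichler B e (t • q) *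
      eichler B w (t • -q') * eichler B e (t • -q)) := by
    ext v
    simp only [Module.End.mul_apply, eichler_apply, map_add, map_smul, map_neg,
      LinearMap.neg_apply, smul_neg,
      LinearMap.smul_apply, smul_eq_mul, h1, h2, h3, h4, h5, hqq, hq.1, hq.2, hq'.1, hq'.2,
      H.left_left, H.right_right, H.left_right, H.right_left, H.alt.self_eq_zero]
    module
  rw [this]
  exact mul_mem (eichler_right_mem hq'.2) (mul_mem (mul_mem (eichler_left_mem hq.1)
    (eichler_right_mem (by simp [hq'.2]))) (eichler_left_mem (by simp [hq.1])))

theorem transvec_levi_mem {q : P} (hq : B e q = 0 ∧ B w q = 0) (c : S) :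
    transvec B q (t * t * c) ∈ eichlerMonoid B e w t := by
  rw [transvec_eq_eichler hh]
  exact H.eichler_levi_mem hq (by simp [hq.1, hq.2]) (by simp [H.alt.self_eq_zero])

/-! ### Absorption of the transvections along `e` -/

theorem eichler_plane_mem {u : P} (hu : B e u = 0 ∧ B w u = 0) (c : S) :
    eichler B (w + c • e) (t • u) ∈ eichlerMonoid B e w t := by
  have h1 : B u e = 0 := by rw [← H.alt.neg_eq, hu.1, neg_zero]
  have : eichler B (w + c • e) (t • u) = eichler B w (t • u) * eichler B e (t • c • u) *
      transvec B u (t * t * -c) := by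
    ext v
    simp only [Module.End.mul_apply, eichler_apply, transvec_apply, map_add, map_smul,
      LinearMap.smul_apply, LinearMap.add_apply, smul_eq_mul, h1, hu.1, hu.2,
      H.right_left, H.alt.self_eq_zero]
    module
  rw [this]
  exact mul_mem (mul_mem (eichler_right_mem hu.2) (eichler_left_mem (by simp [hu.1])))
    (H.transvec_levi_mem hh hu _)

/-- The orthogonal hyperbolic pair is used here: it makes a transvection along the tilted axis a
commutator of elements covered by `eichler_plane_mem`. -/
theorem transvec_plane_mem {q q' : P} (hq : B e q = 0 ∧ B w q = 0)
    (hq' : B e q' = 0 ∧ B w q' = 0) (hqq : B q q' = 1) (c d : S) :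
    transvec B (w + c • e) (t * t * d) ∈ eichlerMonoid B e w t := by
  -- The commutator produces a doubled parameter, hence the halving.
  have h5 : d = h * d + h * d := by rw [← two_mul, ← mul_assoc, hh, one_mul]
  have h1 : B (w + c • e) q = 0 := by simp [hq.1, hq.2]
  have h2 : B (w + c • e) q' = 0 := by simp [hq'.1, hq'.2]
  rw [h5, transvec_eq_commutator H.alt h1 h2 hqq]
  exact mul_mem (mul_mem (mul_mem (H.eichler_plane_mem hh hq _)
    (H.eichler_plane_mem hh (by simp [hq'.1, hq'.2]) _))
    (H.eichler_plane_mem hh (by simp [hq.1, hq.2]) _))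
    (H.eichler_plane_mem hh (by simp [hq'.1, hq'.2]) _)

omit hh in
/-- The component orthogonal to the hyperbolic pair of a vector orthogonal to `w`. -/
theorem exists_decomp {u : P} (hu : B w u = 0) :
    ∃ (a : S) (r : P), u = a • w + r ∧ B e r = 0 ∧ B w r = 0 := by
  refine ⟨-B e u, u + B e u • w, by module, ?_, ?_⟩
  · simp [H.left_right]
  · simp [H.right_right, hu]

/-- Conjugation fixes the generators along `e` and tilts the axis `w` to `w - 2c e`; the direction
then splits into a part orthogonal to the plane and a multiple of the tilted axis. -/
theorem absorbs_transvec {q q' : P} (hq : B e q = 0 ∧ B w q = 0)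
    (hq' : B e q' = 0 ∧ B w q' = 0) (hqq : B q q' = 1) (c : S) :
    EichlerAbsorbs B e w (eichler B e (c • e)) (eichler B e (-(c • e))) := by
  have h0 : B e (c • e) = 0 := by simp [H.left_left]
  have hgg := eichler_mul_neg H.alt h0
  refine absorbs_of_generators hgg (eichler_neg_mul H.alt h0) 2 ?_ ?_
  · intro t u hu
    rw [conj_eichler (eichler_isometry H.alt h0) hgg]
    have : eichler B e (c • e) u = u := by simp [hu]
    have h' : eichler B e (c • e) e = e := by simp [H.left_left]
    rw [map_smul, this, h', pow_two, mul_smul]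
    exact eichler_left_mem (by simp [hu])
  · intro t u hu
    obtain ⟨a, r, rfl, hr⟩ := H.exists_decomp hu
    rw [conj_eichler (eichler_isometry H.alt h0) hgg]
    have h1 : eichler B e (c • e) r = r := by simp [hr.1]
    have h' : eichler B e (c • e) w = w + (-2 * c) • e := by
      simp only [eichler_apply, map_smul, LinearMap.smul_apply, H.left_right]; module
    rw [map_smul, map_add, map_smul, h1, h', smul_add, smul_smul, eichler_smul_self_add H.alt]
    · refine mul_mem ?_ ?_
      · rw [pow_two, mul_smul t t r]
        exact H.eichler_plane_mem hh (by simp [hr.1, hr.2]) _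
      · rw [show 2 * (t ^ 2 * a) = t * t * (2 * a) by ring]
        exact H.transvec_plane_mem hh hq hq' hqq _ _
    · simp [hr.1, hr.2]

/-! ### Absorption of the short root elements along `e` -/

theorem transvec_sub_mem {p : P} (hp : B e p = 0 ∧ B w p = 0) (d : S) :
    transvec B (w - p) (t * t * d) ∈ eichlerMonoid B e w t := by
  have h1 : B p w = 0 := by rw [← H.alt.neg_eq, hp.2, neg_zero]
  have : transvec B (w - p) (t * t * d) = transvec B w (t * (t * d)) * transvec B p (t * t * d) *
      eichler B w (t • (t * d) • -p) := by
    ext v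
    simp only [Module.End.mul_apply, eichler_apply, transvec_apply, map_add, map_smul, map_sub,
      map_neg, LinearMap.neg_apply, LinearMap.smul_apply, LinearMap.sub_apply, smul_eq_mul, h1,
      hp.2, H.right_right, H.alt.self_eq_zero]
    module
  rw [this]
  exact mul_mem (mul_mem (H.transvec_right_mem hh _) (H.transvec_levi_mem hh hp _))
    (eichler_right_mem (by simp [hp.2]))

omit hh in
theorem eichler_sub_mem {p r : P} (hp : B e p = 0 ∧ B w p = 0) (hr : B e r = 0 ∧ B w r = 0)
    (hpr : B p r = 0) : eichler B (w - p) ((t * t) • r) ∈ eichlerMonoid B e w t := by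
  have h3 : B r p = 0 := by rw [← H.alt.neg_eq, hpr, neg_zero]
  have : eichler B (w - p) ((t * t) • r) = eichler B w (t • t • r) *
      eichler B p ((t * t) • -r) := by
    ext v
    simp only [Module.End.mul_apply, eichler_apply, map_add, map_smul, map_sub,
      map_neg, LinearMap.neg_apply, LinearMap.smul_apply, LinearMap.sub_apply, smul_eq_mul,
      h3, hp.2, hr.2, H.alt.self_eq_zero]
    module
  rw [this]
  exact mul_mem (eichler_right_mem (by simp [hr.2]))
    (H.eichler_levi_mem hp (by simp [hr.1, hr.2]) (by simp [hpr]))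

/-- The vector `p' + c e` is orthogonal to `w - c p`, so transvections along it fix this axis while
moving `p` by a multiple of `p' + c e`. Conjugating the transformation with direction a multiple of
`p`, then cancelling that multiple, leaves the desired direction and a transvection along the axis.
-/
theorem eichler_sub_dual_mem {p p' : P} (hp : B e p = 0 ∧ B w p = 0)
    (hp' : B e p' = 0 ∧ B w p' = 0) (hpp : B p p' = 1) (c d : S) :
    eichler B (w - c • p) (t ^ 4 • d • (p' + c • e)) ∈ eichlerMonoid B e w t := by
  have h1 : B p w = 0 := by rw [← H.alt.neg_eq, hp.2, neg_zero]
  have h2 : B p' w = 0 := by rw [← H.alt.neg_eq, hp'.2, neg_zero]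
  have h3 : B p e = 0 := by rw [← H.alt.neg_eq, hp.1, neg_zero]
  have h4 : B p' e = 0 := by rw [← H.alt.neg_eq, hp'.1, neg_zero]
  have h5 : B p' p = -1 := by rw [← H.alt.neg_eq, hpp]
  have hτ : ∀ s : S, transvec B (p' + c • e) (t * t * s) ∈ eichlerMonoid B e w t := by
    intro s
    have : transvec B (p' + c • e) (t * t * s) = transvec B p' (t * t * s) *
        transvec B e (t * (t * s * c ^ 2)) * eichler B e (t • (t * s * c) • p') := by
      ext v
      simp only [Module.End.mul_apply, eichler_apply, transvec_apply, map_add, map_smul,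
        LinearMap.add_apply, LinearMap.smul_apply, smul_eq_mul, h4, hp'.1, H.left_left,
        H.alt.self_eq_zero]
      module
    rw [this]
    exact mul_mem (mul_mem (H.transvec_levi_mem hh hp' _) (H.transvec_left_mem hh _))
      (eichler_left_mem (by simp [hp'.1]))
  have : eichler B (w - c • p) (t ^ 4 • d • (p' + c • e)) =
      transvec B (p' + c • e) (t * t * 1) * eichler B (w - c • p) ((t * t) • -d • p) *
      transvec B (p' + c • e) (t * t * -1) * eichler B (w - c • p) ((t * t) • d • p) *
      transvec B (w - c • p) (t * t * (t ^ 4 * d ^ 2)) := by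
    ext v
    simp only [Module.End.mul_apply, eichler_apply, transvec_apply, map_add, map_smul, map_sub,
      LinearMap.add_apply, LinearMap.smul_apply, LinearMap.sub_apply, smul_eq_mul, h1,
      h2, h3, h4, h5, hpp, hp.1, hp.2, hp'.1, hp'.2, H.left_left, H.right_left, H.left_right,
      H.right_right, H.alt.self_eq_zero]
    module
  rw [this]
  have hcp : B e (c • p) = 0 ∧ B w (c • p) = 0 := by simp [hp.1, hp.2]
  refine mul_mem (mul_mem (mul_mem (mul_mem (hτ _) ?_) (hτ _)) ?_)
    (H.transvec_sub_mem hh hcp _)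
  · exact H.eichler_sub_mem hcp (by simp [hp.1, hp.2]) (by simp [H.alt.self_eq_zero])
  · exact H.eichler_sub_mem hcp (by simp [hp.1, hp.2]) (by simp [H.alt.self_eq_zero])

theorem absorbs_unimodular {p p' : P} (hp : B e p = 0 ∧ B w p = 0)
    (hp' : B e p' = 0 ∧ B w p' = 0) (hpp : B p p' = 1) (c : S) :
    EichlerAbsorbs B e w (eichler B e (c • p)) (eichler B e (-(c • p))) := by
  have h1 : B p w = 0 := by rw [← H.alt.neg_eq, hp.2, neg_zero]
  have h3 : B p e = 0 := by rw [← H.alt.neg_eq, hp.1, neg_zero]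
  have h0 : B e (c • p) = 0 := by simp [hp.1]
  have hgg := eichler_mul_neg H.alt h0
  refine absorbs_of_generators hgg (eichler_neg_mul H.alt h0) 4 ?_ ?_
  · intro t u hu
    rw [conj_eichler (eichler_isometry H.alt h0) hgg]
    have h' : eichler B e (c • p) e = e := by simp [H.left_left, h3]
    rw [map_smul, h', show t ^ 4 = t * t ^ 3 by ring, mul_smul]
    refine eichler_left_mem ?_
    simp [hu, H.left_left]
  · intro t u hu
    obtain ⟨a, r, rfl, hr⟩ := H.exists_decomp hu
    have h5 : B r p = - B p r := by rw [H.alt.neg_eq]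
    have h6 : B r w = 0 := by rw [← H.alt.neg_eq, hr.2, neg_zero]
    have h7 : B p' w = 0 := by rw [← H.alt.neg_eq, hp'.2, neg_zero]
    have h8 : B p' p = -1 := by rw [← H.alt.neg_eq, hpp]
    rw [conj_eichler (eichler_isometry H.alt h0) hgg]
    have hw : eichler B e (c • p) w = w - c • p := by
      simp only [eichler_apply, map_smul, LinearMap.smul_apply, H.left_right, h1, smul_zero]; module
    have hr' : eichler B e (c • p) r = r + (c * B p r) • e := by
      simp only [eichler_apply, map_smul, LinearMap.smul_apply, hr.1, smul_eq_mul]; module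
    rw [map_smul, map_add, map_smul, hw, hr', smul_add, smul_smul, eichler_smul_self_add H.alt]
    · refine mul_mem ?_ ?_
      -- The first summand is orthogonal to `p` (`eichler_sub_mem`); the second is the dual
      -- direction (`eichler_sub_dual_mem`).
      · have key : t ^ 4 • (r + (c * B p r) • e) = (t * t) • (t * t) • (r - B p r • p') +
            t ^ 4 • B p r • (p' + c • e) := by module
        have hcor : B ((t * t) • (t * t) • (r - B p r • p')) (t ^ 4 • B p r • (p' + c • e)) =
            t * t * (t ^ 6 * B p r * B r p') := by
          have h9 : B r e = 0 := by rw [← H.alt.neg_eq, hr.1, neg_zero]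
          have h10 : B p' e = 0 := by rw [← H.alt.neg_eq, hp'.1, neg_zero]
          simp only [map_add, map_smul, map_sub, LinearMap.smul_apply, LinearMap.sub_apply,
            smul_eq_mul, h9, h10, H.alt.self_eq_zero]
          ring
        have hcp : B e (c • p) = 0 ∧ B w (c • p) = 0 := by simp [hp.1, hp.2]
        rw [key, eichler_add H.alt, hcor]
        · refine mul_mem (mul_mem (H.eichler_sub_mem hcp ?_ ?_)
            (H.eichler_sub_dual_mem hh hp hp' hpp _ _)) ?_
          · simp [hr.1, hr.2, hp'.1, hp'.2]
          · simp [hpp]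
          · rw [← mul_neg]
            exact H.transvec_sub_mem hh hcp _
        · simp [hr.2, hp'.2, hpp]
        · simp [hp'.2, hpp, h3, H.right_left]; ring
      · rw [show 2 * (t ^ 4 * a) = t * t * (t * t * (2 * a)) by ring]
        exact H.transvec_sub_mem hh (by simp [hp.1, hp.2]) _
    · simp only [map_add, map_smul, map_sub, LinearMap.smul_apply, LinearMap.sub_apply,
        smul_eq_mul, hr.2, H.right_left, h3]
      ring

theorem absorbs_left {q q' : P} (hq : B e q = 0 ∧ B w q = 0)
    (hq' : B e q' = 0 ∧ B w q' = 0) (hqq : B q q' = 1) {u : P} (hu : B e u = 0) :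
    ∃ g', EichlerAbsorbs B e w (eichler B e u) g' := by
  have h5 : B q' q = -1 := by rw [← H.alt.neg_eq, hqq]
  obtain ⟨a, r, rfl, hr1, hr2⟩ : ∃ (a : S) (r : P), u = a • e + r ∧ B e r = 0 ∧ B w r = 0 :=
    ⟨B w u, u - B w u • e, by module, by simp [hu, H.left_left], by simp [H.right_left]⟩
  -- An arbitrary `r` need not pair to `1` with anything. Removing its components in the plane of
  -- `q`, `q'` and adding `q` gives `B p q' = 1`, so `r` is a combination of the unimodular vectors
  -- `p`, `q`, `q'`.
  set p := r - (B r q') • q - (B q r) • q' + q with hp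
  have hp1 : B e p = 0 ∧ B w p = 0 := by simp [hp, hr1, hr2, hq, hq']
  have hpq : B p q' = 1 := by simp [hp, hqq, H.alt.self_eq_zero]
  have A1 := H.absorbs_unimodular hh hp1 hq' hpq 1
  have A2 := H.absorbs_unimodular hh hq hq' hqq (B r q' - 1)
  have A3 := H.absorbs_unimodular (p := q') (p' := -q) hh hq' (by simp [hq]) (by simp [h5]) (B q r)
  have z1 : B e ((1 : S) • p) = 0 := by simp [hp1]
  have z2 : B e ((B r q' - 1) • q) = 0 := by simp [hq]
  have z3 : B e (B q r • q') = 0 := by simp [hq']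
  set s1 := h * B ((1 : S) • p) ((B r q' - 1) • q) with hs1
  set s2 := h * B ((1 : S) • p + (B r q' - 1) • q + s1 • e) (B q r • q') with hs2
  have A4 := H.absorbs_transvec hh hq hq' hqq (a - s1 - s2)
  have key : eichler B e (a • e + r) = eichler B e ((1 : S) • p) *
      eichler B e ((B r q' - 1) • q) * eichler B e (B q r • q') *
      eichler B e ((a - s1 - s2) • e) := by
    rw [eichler_mul_eichler' H.alt hh z1 z2, ← hs1, eichler_mul_eichler' H.alt hh ?_ z3, ← hs2,
      eichler_mul_eichler' H.alt hh ?_ ?_]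
    · congr 1
      have : ∀ y, B e y = 0 → B y e = 0 := fun y hy => by rw [← H.alt.neg_eq, hy, neg_zero]
      have h6 : B ((1 : S) • p + (B r q' - 1) • q + s1 • e + B q r • q' + s2 • e)
          ((a - s1 - s2) • e) = 0 := by
        simp [this _ hp1.1, this _ hq.1, this _ hq'.1, H.left_left]
      rw [h6, hp]
      module
    · simp [hp1, hq, hq', H.left_left]
    · simp [H.left_left]
    · simp [hp1, hq, H.left_left]
  rw [key]
  exact ⟨_, ((A1.mul A2).mul A3).mul A4⟩

/-- Conjugation by any product of Eichler generators sends sufficiently divisible generators into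
the monoid of divisible ones. -/
theorem absorbs_of_mem {q q' : P} (hq : B e q = 0 ∧ B w q = 0)
    (hq' : B e q' = 0 ∧ B w q' = 0) (hqq : B q q' = 1) {f : Module.End S P}
    (hf : f ∈ eichlerMonoid B e w 1) : ∃ g', EichlerAbsorbs B e w f g' := by
  induction hf using Submonoid.closure_induction with
  | mem x hx =>
    rcases hx with ⟨u, hu, rfl⟩ | ⟨u, hu, rfl⟩
    · exact H.absorbs_left hh hq hq' hqq (by simpa using hu)
    · obtain ⟨g', hg'⟩ := H.swap.absorbs_left hh (q := q) (q' := q') (u := (1 : S) • u)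
        (by simp [hq]) (by simp [hq']) hqq (by simpa using hu)
      exact ⟨g', hg'.swap⟩
  | one => exact ⟨1, by simp, by simp, 1, by simp⟩
  | mul x y _ _ hx hy =>
    obtain ⟨x', hx⟩ := hx
    obtain ⟨y', hy⟩ := hy
    exact ⟨_, hx.mul hy⟩

end IsHyperbolicPair

end Eichler

/-! ### The matrices `C_φ(v)` and `R_φ(v)` as Eichler transformations. -/

section Generators

variable {S : Type*} [CommRing S] {m : ℕ}

/-- `φ` is skew-symmetric and invertible over a ring in which `2` is invertible. -/
structure IsSymplecticForm (φ : Matrix (Fin (m + 1)) (Fin (m + 1)) S) : Prop where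
  skew : φᵀ = -φ
  det : IsUnit φ.det
  two : IsUnit (2 : S)

/-- The two families of elementary symplectic matrices attached to `φ`. -/
noncomputable def vasersteinMatrix (φ : Matrix (Fin (m + 1)) (Fin (m + 1)) S) (b : Bool)
    (v : Fin m → S) : Matrix (Fin (m + 1)) (Fin (m + 1)) S :=
  bif b then vasersteinC φ v else vasersteinR φ v

/-- The common axis of the elementary symplectic matrices of one family: the first basis vector
or its dual with respect to `φ`. -/
noncomputable def axisVec (φ : Matrix (Fin (m + 1)) (Fin (m + 1)) S) (b : Bool) :
    Fin (m + 1) → S := bif b then φ⁻¹ 0 else Pi.single 0 1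

/-- The direction of the Eichler transformation given by an elementary symplectic matrix. -/
noncomputable def directionVec (φ : Matrix (Fin (m + 1)) (Fin (m + 1)) S) (b : Bool)
    (v : Fin m → S) : Fin (m + 1) → S :=
  bif b then
    (Fin.cons 0 v : Fin (m + 1) → S) -
      (Ring.inverse 2 * (Fin.cons 0 v ⬝ᵥ φ *ᵥ Pi.single 0 1)) • φ⁻¹ 0
  else
    (Ring.inverse 2 * (φ⁻¹ 0 ⬝ᵥ Fin.cons 0 v)) • Pi.single 0 1 -
      φ⁻¹ *ᵥ (Fin.cons 0 v : Fin (m + 1) → S)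

theorem Fin.cons_zero_smul (t : S) (v : Fin m → S) :
    (Fin.cons 0 (t • v) : Fin (m + 1) → S) = t • (Fin.cons 0 v : Fin (m + 1) → S) := by
  ext i; refine Fin.cases ?_ (fun i => ?_) i <;> simp

theorem Fin.cons_zero_add (v v' : Fin m → S) :
    (Fin.cons 0 (v + v') : Fin (m + 1) → S) =
      (Fin.cons 0 v : Fin (m + 1) → S) + (Fin.cons 0 v' : Fin (m + 1) → S) := by
  ext i; refine Fin.cases ?_ (fun i => ?_) i <;> simp

variable (φ : Matrix (Fin (m + 1)) (Fin (m + 1)) S)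

theorem directionVec_smul (b : Bool) (t : S) (v : Fin m → S) :
    directionVec φ b (t • v) = t • directionVec φ b v := by
  cases b
  · simp only [directionVec, cond_false, Fin.cons_zero_smul, dotProduct_smul, mulVec_smul,
      smul_eq_mul]
    module
  · simp only [directionVec, cond_true, Fin.cons_zero_smul, smul_dotProduct, smul_eq_mul]
    module

theorem directionVec_add (b : Bool) (v v' : Fin m → S) :
    directionVec φ b (v + v') = directionVec φ b v + directionVec φ b v' := by
  cases b
  · simp only [directionVec, cond_false, Fin.cons_zero_add, dotProduct_add, mulVec_add]
    module
  · simp only [directionVec, cond_true, Fin.cons_zero_add, add_dotProduct]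
    module

omit φ in
theorem dotProduct_mem {n : ℕ} {J : Ideal S} {u : Fin n → S} (y : Fin n → S)
    (hu : ∀ i, u i ∈ J) : u ⬝ᵥ y ∈ J :=
  sum_mem fun i _ => J.mul_mem_right _ (hu i)

omit φ in
theorem mulVec_mem {n : ℕ} {J : Ideal S} {u : Fin n → S} (A : Matrix (Fin n) (Fin n) S)
    (hu : ∀ i, u i ∈ J) (i : Fin n) : (A *ᵥ u) i ∈ J := by
  rw [mulVec, dotProduct_comm]
  exact dotProduct_mem _ hu

theorem directionVec_mem {J : Ideal S} {v : Fin m → S} (b : Bool) (hv : ∀ i, v i ∈ J)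
    (i : Fin (m + 1)) : directionVec φ b v i ∈ J := by
  have hc : ∀ i, (Fin.cons 0 v : Fin (m + 1) → S) i ∈ J := fun i => by
    refine Fin.cases ?_ (fun i => ?_) i
    · exact zero_mem J
    · exact hv i
  cases b
  · refine sub_mem (J.mul_mem_right _ (J.mul_mem_left _ ?_)) (mulVec_mem _ hc i)
    rw [dotProduct_comm]
    exact dotProduct_mem _ hc
  · exact sub_mem (hc i) (J.mul_mem_right _ (J.mul_mem_left _ (dotProduct_mem _ hc)))

namespace IsSymplecticForm

variable {φ} (H : IsSymplecticForm φ)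
include H

theorem two_mul_half : (2 : S) * Ring.inverse 2 = 1 := Ring.mul_inverse_cancel _ H.two

theorem eq_zero_of_eq_neg {a : S} (h : a = -a) : a = 0 := by
  have := H.two_mul_half
  linear_combination (Ring.inverse 2) * h - a * this

theorem inv_skew : (φ⁻¹)ᵀ = -φ⁻¹ := by
  rw [Matrix.transpose_nonsing_inv, H.skew]
  apply Matrix.inv_eq_left_inv
  rw [neg_mul_neg, Matrix.nonsing_inv_mul _ H.det]

theorem apply_self (i : Fin (m + 1)) : φ i i = 0 :=
  H.eq_zero_of_eq_neg (by simpa using congrFun (congrFun H.skew i) i)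

theorem inv_apply_self (i : Fin (m + 1)) : φ⁻¹ i i = 0 :=
  H.eq_zero_of_eq_neg (by simpa using congrFun (congrFun H.inv_skew i) i)

theorem dotProduct_mulVec_comm (x y : Fin (m + 1) → S) : x ⬝ᵥ φ *ᵥ y = -(y ⬝ᵥ φ *ᵥ x) := by
  rw [Matrix.dotProduct_mulVec, ← Matrix.mulVec_transpose, H.skew, dotProduct_comm,
    Matrix.neg_mulVec, dotProduct_neg]

theorem isAlt : (Matrix.toBilin' φ).IsAlt := fun x => by
  rw [Matrix.toBilin'_apply']
  exact H.eq_zero_of_eq_neg (H.dotProduct_mulVec_comm x x)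

omit H in
theorem apply_single (x : Fin (m + 1) → S) : (Pi.single 0 1 : Fin (m + 1) → S) ⬝ᵥ x = x 0 := by
  simp

theorem toBilin'_dual (x : Fin (m + 1) → S) : Matrix.toBilin' φ (φ⁻¹ 0) x = x 0 := by
  have : (φ⁻¹ *ᵥ (φ *ᵥ x)) 0 = x 0 := by
    rw [Matrix.mulVec_mulVec, Matrix.nonsing_inv_mul _ H.det, Matrix.one_mulVec]
  rw [Matrix.toBilin'_apply']
  exact this

theorem toBilin'_inv_mulVec (x y : Fin (m + 1) → S) :
    Matrix.toBilin' φ (φ⁻¹ *ᵥ x) y = -(x ⬝ᵥ y) := by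
  rw [Matrix.toBilin'_apply', H.dotProduct_mulVec_comm, Matrix.mulVec_mulVec,
    Matrix.mul_nonsing_inv _ H.det, Matrix.one_mulVec, dotProduct_comm]

theorem hyperbolic : IsHyperbolicPair (Matrix.toBilin' φ) (axisVec φ false) (axisVec φ true) :=
  ⟨H.isAlt, by simp [axisVec, H.toBilin'_dual]⟩

theorem axis_direction (b : Bool) (v : Fin m → S) :
    Matrix.toBilin' φ (axisVec φ b) (directionVec φ b v) = 0 := by
  cases b
  · have h1 := H.isAlt.self_eq_zero (Pi.single 0 1)
    simp only [axisVec, directionVec, cond_false, map_sub, map_smul, h1]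
    rw [← H.isAlt.neg_eq, H.toBilin'_inv_mulVec]
    simp
  · simp [axisVec, directionVec, H.toBilin'_dual, H.inv_apply_self]

/-- A multiple of the axis inside the direction enters through both rank-one terms and so counts
twice; this explains the halves in `directionVec`. -/
theorem toLin'_vaserstein (b : Bool) (v : Fin m → S) :
    Matrix.toLin' (vasersteinMatrix φ b v) =
      eichler (Matrix.toBilin' φ) (axisVec φ b) (directionVec φ b v) := by
  have hh := H.two_mul_half
  refine LinearMap.ext fun x => ?_
  cases b
  · rw [toLin'_apply, eichler_apply]
    simp only [vasersteinMatrix, axisVec, directionVec, cond_false, map_sub, map_smul,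
      LinearMap.sub_apply, LinearMap.smul_apply, H.toBilin'_inv_mulVec]
    set e : Fin (m + 1) → S := Pi.single 0 1 with he
    set vb : Fin (m + 1) → S := Fin.cons 0 v with hv
    have hs : Matrix.toBilin' φ e x = -∑ j : Fin m, φ j.succ 0 * x j.succ := by
      rw [toBilin'_apply', apply_single, mulVec, dotProduct, Fin.sum_univ_succ, H.apply_self,
        zero_mul, zero_add, ← Finset.sum_neg_distrib]
      refine Finset.sum_congr rfl fun j _ => ?_
      have := congrFun (congrFun H.skew 0) j.succ
      rw [transpose_apply, Matrix.neg_apply] at this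
      rw [this]; ring
    trans x + (vb ⬝ᵥ x) • e + (∑ j : Fin m, φ j.succ 0 * x j.succ) •
      (φ⁻¹ *ᵥ vb - (φ⁻¹ 0 ⬝ᵥ vb) • e)
    · ext i
      refine Fin.cases ?_ (fun i => ?_) i
      · simp [vasersteinR, mulVec, hv, he, dotProduct, Fin.sum_univ_succ]
      · simp only [vasersteinR, mulVec, dotProduct, of_apply, Fin.cons_succ, Fin.sum_univ_succ,
          Fin.cons_zero, zero_mul, zero_add, vasersteinBeta, hv, he, Pi.add_apply, Pi.sub_apply,
          Pi.smul_apply, smul_eq_mul, mul_zero, Pi.single_apply, Fin.succ_ne_zero,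
          if_false, add_zero, sub_zero, Matrix.add_apply, add_mul, Finset.sum_add_distrib]
        congr 1
        · simp [Matrix.one_apply]
        · rw [Finset.sum_mul]
          refine Finset.sum_congr rfl fun j _ => ?_
          simp only [Matrix.mul_apply, submatrix_apply, vecMulVec_apply, Finset.mul_sum,
            Finset.sum_mul]
          refine Finset.sum_congr rfl fun k _ => ?_
          ring
    · rw [hs]
      generalize (∑ j : Fin m, φ j.succ 0 * x j.succ) = s
      have h3 : φ⁻¹ 0 ⬝ᵥ vb = 2 * (Ring.inverse 2 * φ⁻¹ 0 ⬝ᵥ vb) := by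
        rw [← mul_assoc, hh, one_mul]
      generalize Ring.inverse 2 * φ⁻¹ 0 ⬝ᵥ vb = d at h3 ⊢
      rw [h3]
      simp only [smul_eq_mul]
      module
  · rw [toLin'_apply, eichler_apply]
    simp only [vasersteinMatrix, axisVec, directionVec, cond_true, map_sub, map_smul,
      LinearMap.sub_apply, LinearMap.smul_apply, H.toBilin'_dual]
    set vb : Fin (m + 1) → S := Fin.cons 0 v with hv
    trans x + (toBilin' φ vb x - (vb ⬝ᵥ φ *ᵥ Pi.single 0 1) * x 0) • φ⁻¹ 0 + x 0 • vb
    · ext i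
      refine Fin.cases ?_ (fun i => ?_) i
      · simp [vasersteinC, mulVec, hv, dotProduct, Fin.sum_univ_succ, H.inv_apply_self]
      · simp only [toBilin'_apply']
        simp only [vasersteinC, mulVec, dotProduct, of_apply, Fin.cons_succ, Fin.sum_univ_succ,
          Fin.cons_zero, zero_mul, zero_add, vasersteinAlpha, hv, Pi.add_apply,
          Pi.smul_apply, smul_eq_mul, mul_zero, mul_one, Pi.single_apply, Fin.succ_ne_zero,
          if_false, add_zero, if_true, Matrix.add_apply, add_mul, Finset.sum_add_distrib,
          Finset.sum_const_zero, mul_add, Finset.sum_mul, sub_mul]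
        have h1 : ∑ j, (1 : Matrix (Fin m) (Fin m) S) i j * x j.succ = x i.succ := by
          simp [Matrix.one_apply]
        rw [h1]
        have h2 : ∑ j, (vecMulVec (fun i => φ⁻¹ 0 i.succ) v * φ.submatrix Fin.succ Fin.succ) i j *
            x j.succ = ∑ j, v j * (∑ k : Fin m, φ j.succ k.succ * x k.succ) * φ⁻¹ 0 i.succ := by
          simp only [Matrix.mul_apply, submatrix_apply, vecMulVec_apply, Finset.mul_sum,
            Finset.sum_mul]
          rw [Finset.sum_comm]
          refine Finset.sum_congr rfl fun j _ => Finset.sum_congr rfl fun k _ => ?_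
          ring
        have h3 : ∀ j, v j * (φ j.succ 0 * x 0) * φ⁻¹ 0 i.succ =
          v j * φ j.succ 0 * x 0 * φ⁻¹ 0 i.succ := fun j => by ring
        rw [h2]
        simp only [h3]
        ring
    · generalize vb ⬝ᵥ φ *ᵥ Pi.single 0 1 = s
      have h3 : s = 2 * (Ring.inverse 2 * s) := by
        rw [← mul_assoc, hh, one_mul]
      generalize Ring.inverse 2 * s = d at h3 ⊢
      rw [h3]
      simp only [smul_eq_mul]
      module

/-- The ideal clause keeps track of relative generators when directions are modified. -/
theorem exists_direction (b : Bool) {u : Fin (m + 1) → S}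
    (hu : Matrix.toBilin' φ (axisVec φ b) u = 0) :
    ∃ v, u = directionVec φ b v ∧ ∀ J : Ideal S, (∀ i, u i ∈ J) → ∀ i, v i ∈ J := by
  have hh := H.two_mul_half
  have hcons : ∀ y : Fin (m + 1) → S, y 0 = 0 →
      (Fin.cons 0 (fun i => y i.succ) : Fin (m + 1) → S) = y := by
    intro y hy; ext i; refine Fin.cases ?_ (fun i => ?_) i <;> simp [hy]
  cases b
  · simp only [axisVec, cond_false] at hu
    set e : Fin (m + 1) → S := Pi.single 0 1 with he
    set a := toBilin' φ u (φ⁻¹ 0) with ha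
    -- Any `a` makes the first entry of `y` vanish; this one makes the coefficient of `e` in the
    -- direction come out right.
    set y := φ *ᵥ (a • e - u) with hy
    have hee := H.isAlt.self_eq_zero e
    have hy0 : y 0 = 0 := by
      have h1 : toBilin' φ e (a • e - u) = 0 := by rw [map_sub, map_smul, hee, hu]; simp
      rwa [toBilin'_apply', apply_single] at h1
    refine ⟨fun i => y i.succ, ?_, fun J hJ i => mulVec_mem φ (fun j => ?_) _⟩
    swap
    · exact sub_mem (J.mul_mem_right _ (by
        rw [ha, toBilin'_apply']; exact dotProduct_mem _ hJ)) (hJ j)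
    simp only [directionVec, cond_false]
    rw [hcons y hy0, hy, mulVec_mulVec, nonsing_inv_mul _ H.det, one_mulVec, ← toBilin'_apply',
      map_sub, map_smul, H.toBilin'_dual, ← H.isAlt.neg_eq, ← ha]
    have : Ring.inverse 2 * (a • e 0 - -a) = a := by
      simp [he]
      linear_combination a * hh
    rw [this]
    module
  · simp only [axisVec, cond_true, H.toBilin'_dual] at hu
    set e : Fin (m + 1) → S := Pi.single 0 1 with he
    set a := toBilin' φ u e with ha
    set y := u + a • φ⁻¹ 0 with hy
    have hy0 : y 0 = 0 := by simp [hy, hu, H.inv_apply_self]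
    refine ⟨fun i => y i.succ, ?_, fun J hJ i => add_mem (hJ _) (J.mul_mem_right _ ?_)⟩
    swap
    · rw [ha, toBilin'_apply']; exact dotProduct_mem _ hJ
    simp only [directionVec, cond_true]
    rw [hcons y hy0, hy, ← toBilin'_apply', map_add, map_smul, LinearMap.add_apply,
      LinearMap.smul_apply, H.toBilin'_dual, ← he, ← ha]
    have : Ring.inverse 2 * (a + a • e 0) = a := by
      simp [he]
      linear_combination a * hh
    rw [this]
    module

end IsSymplecticForm

end Generators

/-! ### Invertibility of a skew-symmetric matrix of Pfaffian `1`. -/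

section Pfaffian

theorem pfaffian_map {R S : Type*} [CommRing R] [CommRing S] (f : R →+* S) (k : ℕ)
    (A : Matrix (Fin k) (Fin k) R) : pfaffian k (A.map f) = f (pfaffian k A) := by
  induction k using Nat.twoStepInduction with
  | zero => simp [pfaffian]
  | one => simp [pfaffian]
  | more k ih _ =>
    simp only [pfaffian, map_sum, map_mul, map_pow, map_neg, map_one, ← ih]
    rfl

theorem pfaffian_eq_zero_of_row {R : Type*} [CommRing R] {k : ℕ}
    (A : Matrix (Fin (k + 1)) (Fin (k + 1)) R) (h : ∀ j, A 0 j = 0) : pfaffian (k + 1) A = 0 := by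
  cases k with
  | zero => simp [pfaffian]
  | succ k => simp [pfaffian, h]

variable {R M : Type*} [CommRing R] [AddCommGroup M] [Module R M]

/-- This alternating expansion has the shape of the recursion defining `pfaffian`. -/
theorem contractLeft_ιMulti (d : Module.Dual R M) (k : ℕ) (v : Fin (k + 1) → M) :
    CliffordAlgebra.contractLeft d (ExteriorAlgebra.ιMulti R (k + 1) v) =
      ∑ j : Fin (k + 1), ((-1) ^ (j : ℕ) * d (v j)) •
        ExteriorAlgebra.ιMulti R k (fun i => v (j.succAbove i)) := by
  induction k with
  | zero =>
    rw [ExteriorAlgebra.ιMulti_succ_apply]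
    erw [CliffordAlgebra.contractLeft_ι_mul]
    simp [Matrix.vecTail, CliffordAlgebra.contractLeft_one]
  | succ k ih =>
    rw [ExteriorAlgebra.ιMulti_succ_apply]
    erw [CliffordAlgebra.contractLeft_ι_mul]
    rw [ih, sub_eq_add_neg]
    erw [Finset.mul_sum]
    rw [← Finset.sum_neg_distrib]
    conv_rhs => rw [Fin.sum_univ_succ]
    congr 1
    · simp [Matrix.vecTail, Function.comp_def]
    · refine Finset.sum_congr rfl fun j _ => ?_
      rw [ExteriorAlgebra.ιMulti_succ_apply]
      erw [mul_smul_comm]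
      simp only [Fin.val_succ, pow_succ, mul_neg, mul_one, neg_mul, neg_smul]
      simp [Matrix.vecTail, Function.comp_def, ExteriorAlgebra.ι]

/-- The scalar part of an element of the exterior algebra after deforming its product by an
alternating form. -/
noncomputable def pfaffianForm (B : LinearMap.BilinForm R M)
    (hB : B.toQuadraticMap = (0 : QuadraticForm R M) - 0) : ExteriorAlgebra R M →ₗ[R] R :=
  ExteriorAlgebra.algebraMapInv.toLinearMap ∘ₗ CliffordAlgebra.changeForm hB

theorem pfaffianForm_ι_mul (B : LinearMap.BilinForm R M)
    (hB : B.toQuadraticMap = (0 : QuadraticForm R M) - 0) (m : M) (x : ExteriorAlgebra R M) :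
    pfaffianForm B hB (ExteriorAlgebra.ι R m * x) =
      - pfaffianForm B hB (CliffordAlgebra.contractLeft (B m) x) := by
  simp only [pfaffianForm, LinearMap.comp_apply, ExteriorAlgebra.ι]
  erw [CliffordAlgebra.changeForm_ι_mul, CliffordAlgebra.changeForm_contractLeft]
  rw [map_sub]
  have h : ∀ y : ExteriorAlgebra R M, ExteriorAlgebra.algebraMapInv (ExteriorAlgebra.ι R m * y) = (0 : R) := by
    intro y; simp [ExteriorAlgebra.algebraMapInv]
  erw [h]
  simp

/-- Deforming the product turns multiplication by a vector into wedge minus contraction, and the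
scalar part kills the wedge. The Pfaffian of a Gram matrix is thus an alternating multilinear
function of the vectors. -/
theorem pfaffianForm_ιMulti (B : LinearMap.BilinForm R M)
    (hB : B.toQuadraticMap = (0 : QuadraticForm R M) - 0) (k : ℕ) (v : Fin k → M) :
    pfaffianForm B hB (ExteriorAlgebra.ιMulti R k v) =
      pfaffian k (Matrix.of fun i j => -B (v i) (v j)) := by
  induction k using Nat.twoStepInduction with
  | zero =>
    rw [ExteriorAlgebra.ιMulti_zero_apply]
    simp only [pfaffian, pfaffianForm, LinearMap.comp_apply]
    erw [CliffordAlgebra.changeForm_one]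
    simp
  | one =>
    rw [ExteriorAlgebra.ιMulti_succ_apply, pfaffianForm_ι_mul, ExteriorAlgebra.ιMulti_zero_apply]
    erw [CliffordAlgebra.contractLeft_one]
    simp [pfaffian]
  | more k ih _ =>
    rw [ExteriorAlgebra.ιMulti_succ_apply, pfaffianForm_ι_mul, contractLeft_ιMulti, map_sum,
      ← Finset.sum_neg_distrib]
    simp only [pfaffian, map_smul, ih, smul_eq_mul]
    refine Finset.sum_congr rfl fun j _ => ?_
    simp only [Matrix.vecTail, Function.comp_apply, Matrix.of_apply]
    rw [mul_neg, neg_mul]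
    rfl

/-- Put a nonzero `x` in the left kernel in place of a basis vector `i` with `x i ≠ 0`. The
alternating form then vanishes, yet it equals `x i` times the Pfaffian. -/
theorem det_ne_zero_of_pfaffian_ne_zero {K : Type*} [Field K] {k : ℕ}
    (A : Matrix (Fin k) (Fin k) K) (hA : ∀ x, x ⬝ᵥ A *ᵥ x = 0) (hp : pfaffian k A ≠ 0) :
    A.det ≠ 0 := by
  intro hdet
  obtain ⟨x, hx0, hx⟩ := Matrix.exists_vecMul_eq_zero_iff.2 hdet
  obtain ⟨i, hi⟩ := Function.ne_iff.1 hx0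
  have : NeZero k := ⟨fun h => by subst h; exact i.elim0⟩
  set B : LinearMap.BilinForm K (Fin k → K) := -Matrix.toBilin' A with hBdef
  have hBa : ∀ y z, B y z = - (y ⬝ᵥ A *ᵥ z) := by
    intro y z; simp [hBdef, Matrix.toBilin'_apply']
  have hB : B.toQuadraticMap = (0 : QuadraticForm K (Fin k → K)) - 0 := by
    ext y; simp [LinearMap.BilinMap.toQuadraticMap_apply, hBa, hA]
  set f := (pfaffianForm B hB).compAlternatingMap (ExteriorAlgebra.ιMulti K k) with hf
  have hfv : ∀ v, f v = pfaffian k (Matrix.of fun i j => -B (v i) (v j)) :=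
    fun v => pfaffianForm_ιMulti B hB k v
  have hfe : f (Pi.basisFun K (Fin k)) = pfaffian k A := by
    rw [hfv]; congr 1; ext a b; simp [hBa]
  -- The swap moves `x` to the first slot, where it produces a zero first row.
  have hx' : f ((Function.update (Pi.basisFun K (Fin k)) i x) ∘ Equiv.swap 0 i) = 0 := by
    rw [hfv]
    obtain ⟨k, rfl⟩ := Nat.exists_eq_succ_of_ne_zero (NeZero.ne k)
    apply pfaffian_eq_zero_of_row
    intro j
    simp [hBa, Matrix.dotProduct_mulVec, hx]
  have hdet' := congrArg (fun g => g (Function.update (Pi.basisFun K (Fin k)) i x))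
    (f.eq_smul_basis_det (Pi.basisFun K (Fin k)))
  rw [f.map_perm, smul_eq_zero_iff_eq] at hx'
  simp only [hx', hfe, AlternatingMap.smul_apply, smul_eq_mul] at hdet'
  rcases mul_eq_zero.1 hdet'.symm with h | h
  · exact hp h
  · apply hi
    rwa [Module.Basis.det_apply, Module.Basis.toMatrix_update, Module.Basis.toMatrix_self,
      ← Matrix.cramer_apply, Matrix.cramer_one] at h

theorem isUnit_det_of_pfaffian {k : ℕ} (A : Matrix (Fin k) (Fin k) R) (h2 : IsUnit (2 : R))
    (hA : Aᵀ = -A) (hp : pfaffian k A = 1) : IsUnit A.det := by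
  by_contra hn
  obtain ⟨m, hm, hmem⟩ := exists_max_ideal_of_mem_nonunits hn
  let f := Ideal.Quotient.mk m
  let _ := Ideal.Quotient.field m
  have h2' : (2 : R ⧸ m) ≠ 0 := by
    have := (h2.map f).ne_zero
    rwa [map_ofNat] at this
  have hAf : (A.map f)ᵀ = - A.map f := by
    rw [← Matrix.transpose_map, hA]; ext; simp
  refine det_ne_zero_of_pfaffian_ne_zero (A.map f) (fun x => ?_) ?_ ?_
  · have h : x ⬝ᵥ A.map f *ᵥ x = - (x ⬝ᵥ A.map f *ᵥ x) := by
      conv_lhs => rw [Matrix.dotProduct_mulVec, ← Matrix.mulVec_transpose, hAf, dotProduct_comm]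
      simp [Matrix.neg_mulVec]
    have : 2 * (x ⬝ᵥ A.map f *ᵥ x) = 0 := by linear_combination h
    exact (mul_eq_zero.1 this).resolve_left h2'
  · rw [pfaffian_map, hp, map_one]; exact one_ne_zero
  · rw [← RingHom.mapMatrix_apply, ← RingHom.map_det]
    exact Ideal.Quotient.eq_zero_iff_mem.2 hmem

end Pfaffian

/-! ### The elementary and relative elementary groups, and their functoriality. -/

section ElementaryGroup

variable {S : Type*} [CommRing S] {m : ℕ}

open Classical in
/-- The elementary symplectic matrices as elements of the general linear group. -/
noncomputable def elemGen (φ : Matrix (Fin (m + 1)) (Fin (m + 1)) S) (b : Bool) (v : Fin m → S) :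
    GL (Fin (m + 1)) S :=
  -- The default `1` never occurs for a symplectic form, by `isUnit_vaserstein`.
  if h : IsUnit (vasersteinMatrix φ b v) then h.unit else 1

/-- The group generated by the elementary symplectic matrices with parameter divisible by `t`. -/
noncomputable def divElemGroup (φ : Matrix (Fin (m + 1)) (Fin (m + 1)) S) (t : S) :
    Subgroup (GL (Fin (m + 1)) S) :=
  Subgroup.closure {g | ∃ b v, g = elemGen φ b (t • v)}

/-- The orthogonal complement of the standard hyperbolic plane contains a hyperbolic pair. -/
def HasOrthogonalPair (φ : Matrix (Fin (m + 1)) (Fin (m + 1)) S) : Prop :=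
  ∃ q q' : Fin (m + 1) → S, q 0 = 0 ∧ q' 0 = 0 ∧ (φ *ᵥ q) 0 = 0 ∧ (φ *ᵥ q') 0 = 0 ∧
    q ⬝ᵥ φ *ᵥ q' = 1

theorem HasOrthogonalPair.map {T : Type*} [CommRing T] (f : S →+* T)
    {φ : Matrix (Fin (m + 1)) (Fin (m + 1)) S} (h : HasOrthogonalPair φ) :
    HasOrthogonalPair (φ.map f) := by
  obtain ⟨q, q', h1, h2, h3, h4, h5⟩ := h
  have hm : ∀ y : Fin (m + 1) → S, φ.map f *ᵥ (f ∘ y) = f ∘ (φ *ᵥ y) := fun y => by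
    ext i; exact (RingHom.map_mulVec f φ y i).symm
  refine ⟨f ∘ q, f ∘ q', by simp [h1], by simp [h2], by simp [hm, h3], by simp [hm, h4], ?_⟩
  rw [hm, ← RingHom.map_dotProduct, h5, map_one]

namespace IsSymplecticForm

variable {φ : Matrix (Fin (m + 1)) (Fin (m + 1)) S} (H : IsSymplecticForm φ)
include H

theorem vaserstein_mul_neg (b : Bool) (v : Fin m → S) :
    vasersteinMatrix φ b v * vasersteinMatrix φ b (-v) = 1 := by
  apply Matrix.toLin'.injective
  have : directionVec φ b (-v) = -directionVec φ b v := by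
    simpa using directionVec_smul φ b (-1) v
  rw [Matrix.toLin'_mul, H.toLin'_vaserstein, H.toLin'_vaserstein, this, Matrix.toLin'_one]
  exact eichler_mul_neg H.isAlt (H.axis_direction b v)

theorem isUnit_vaserstein (b : Bool) (v : Fin m → S) : IsUnit (vasersteinMatrix φ b v) :=
  IsUnit.of_mul_eq_one _ (H.vaserstein_mul_neg b v)

theorem coe_elemGen (b : Bool) (v : Fin m → S) :
    (elemGen φ b v : Matrix (Fin (m + 1)) (Fin (m + 1)) S) = vasersteinMatrix φ b v := by
  rw [elemGen, dif_pos (H.isUnit_vaserstein b v)]; rfl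

omit H in
theorem directionVec_zero (b : Bool) : directionVec φ b 0 = 0 := by
  simpa using directionVec_smul φ b 0 0

theorem elemGen_zero (b : Bool) : elemGen φ b 0 = 1 := by
  ext1
  rw [H.coe_elemGen, Units.val_one]
  apply Matrix.toLin'.injective
  rw [H.toLin'_vaserstein, directionVec_zero, Matrix.toLin'_one]
  ext1 v; ext1; simp

theorem elemGen_neg (b : Bool) (v : Fin m → S) : elemGen φ b (-v) = (elemGen φ b v)⁻¹ := by
  refine eq_inv_of_mul_eq_one_right ?_
  ext1
  rw [Units.val_mul, H.coe_elemGen, H.coe_elemGen, H.vaserstein_mul_neg, Units.val_one]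

theorem toLin'_elemGen (b : Bool) (v : Fin m → S) :
    Matrix.toLin' (elemGen φ b v : Matrix (Fin (m + 1)) (Fin (m + 1)) S) =
      eichler (Matrix.toBilin' φ) (axisVec φ b) (directionVec φ b v) := by
  rw [H.coe_elemGen, H.toLin'_vaserstein]

/-- The Heisenberg cross term is a multiple of the axis divisible by `t`, so it can be moved into
the second direction. -/
theorem exists_elemGen_mul (b : Bool) (v w : Fin m → S) (t : S) :
    ∃ u, elemGen φ b (v + t • w) = elemGen φ b v * elemGen φ b (t • u) ∧
      ∀ J : Ideal S, (∀ i, w i ∈ J) → ∀ i, u i ∈ J := by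
  have hu := H.axis_direction b
  set a := Ring.inverse 2 * toBilin' φ (directionVec φ b v) (directionVec φ b w) with ha
  have h0 : toBilin' φ (axisVec φ b) (directionVec φ b w - a • axisVec φ b) = 0 := by
    simp [hu, H.isAlt.self_eq_zero]
  obtain ⟨u, hu', hJ⟩ := H.exists_direction b h0
  refine ⟨u, ?_, fun J hw => hJ J fun i => sub_mem (directionVec_mem φ b hw i)
    (J.mul_mem_right _ ?_)⟩
  swap
  · rw [ha, toBilin'_apply', H.dotProduct_mulVec_comm]
    exact J.mul_mem_left _ (neg_mem (dotProduct_mem _ (directionVec_mem φ b hw)))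
  ext1
  apply Matrix.toLin'.injective
  have hx : toBilin' φ (directionVec φ b v) (axisVec φ b) = 0 := by
    rw [← H.isAlt.neg_eq, hu, neg_zero]
  rw [Units.val_mul, Matrix.toLin'_mul, H.toLin'_elemGen, H.toLin'_elemGen, H.toLin'_elemGen,
    directionVec_smul, ← hu', ← Module.End.mul_eq_comp,
    eichler_mul_eichler' H.isAlt H.two_mul_half (hu v) (by rw [map_smul, h0, smul_zero]),
    directionVec_add, directionVec_smul, map_smul, map_sub, map_smul, hx]
  congr 1
  have : Ring.inverse 2 * t • ((toBilin' φ) (directionVec φ b v) (directionVec φ b w) - a • 0) =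
    t * a := by rw [smul_zero, sub_zero, smul_eq_mul, ha]; ring
  rw [this]
  module

omit H in
theorem elemGen_mem_divElemGroup (b : Bool) (v : Fin m → S) (t : S) :
    elemGen φ b (t • v) ∈ divElemGroup φ t := Subgroup.subset_closure ⟨b, v, rfl⟩

omit H in
theorem divElemGroup_mono {s t : S} (h : s ∣ t) : divElemGroup φ t ≤ divElemGroup φ s := by
  obtain ⟨r, rfl⟩ := h
  refine (Subgroup.closure_le _).2 ?_
  rintro _ ⟨b, v, rfl⟩
  exact Subgroup.subset_closure ⟨b, r • v, by rw [mul_smul]⟩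

theorem divElemGroup_toSubmonoid (t : S) : (divElemGroup φ t).toSubmonoid =
    Submonoid.closure {g | ∃ b v, g = elemGen φ b (t • v)} := by
  rw [divElemGroup, Subgroup.closure_toSubmonoid]
  congr 1
  refine Set.union_eq_left.2 ?_
  rintro g ⟨b, v, hg⟩
  exact ⟨b, -v, by rw [smul_neg, H.elemGen_neg, ← hg, inv_inv]⟩

/-- The dictionary through which absorption for Eichler transformations reaches matrix groups. -/
theorem mem_divElemGroup_iff (t : S) (g : GL (Fin (m + 1)) S) :
    g ∈ divElemGroup φ t ↔ Matrix.toLin' (g : Matrix (Fin (m + 1)) (Fin (m + 1)) S) ∈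
      eichlerMonoid (Matrix.toBilin' φ) (axisVec φ false) (axisVec φ true) t := by
  constructor
  · intro hg
    rw [← Subgroup.mem_toSubmonoid, H.divElemGroup_toSubmonoid] at hg
    induction hg using Submonoid.closure_induction with
    | mem x hx =>
      obtain ⟨b, v, rfl⟩ := hx
      rw [H.toLin'_elemGen, directionVec_smul]
      cases b
      · exact eichler_left_mem (H.axis_direction false v)
      · exact eichler_right_mem (H.axis_direction true v)
    | one => rw [Units.val_one, Matrix.toLin'_one]; exact one_mem _
    | mul x y _ _ hx hy => rw [Units.val_mul, Matrix.toLin'_mul]; exact mul_mem hx hy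
  · intro hg
    suffices ∀ f ∈ eichlerMonoid (toBilin' φ) (axisVec φ false) (axisVec φ true) t,
        ∃ k ∈ divElemGroup φ t, toLin' (k : Matrix (Fin (m + 1)) (Fin (m + 1)) S) = f by
      obtain ⟨k, hk, hkg⟩ := this _ hg
      rwa [← Units.ext (Matrix.toLin'.injective hkg)]
    intro f hf
    induction hf using Submonoid.closure_induction with
    | mem x hx =>
      rcases hx with ⟨u, hu, rfl⟩ | ⟨u, hu, rfl⟩ <;> obtain ⟨v, rfl, -⟩ := H.exists_direction _ hu <;>
        exact ⟨_, elemGen_mem_divElemGroup _ v t, by rw [H.toLin'_elemGen, directionVec_smul]⟩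
    | one => exact ⟨1, one_mem _, by rw [Units.val_one, Matrix.toLin'_one]; rfl⟩
    | mul x y _ _ hx hy =>
      obtain ⟨k, hk, rfl⟩ := hx
      obtain ⟨l, hl, rfl⟩ := hy
      exact ⟨k * l, mul_mem hk hl, by rw [Units.val_mul, Matrix.toLin'_mul]; rfl⟩

theorem exists_conj_mem (hq : HasOrthogonalPair φ) {γ : GL (Fin (m + 1)) S}
    (hγ : γ ∈ divElemGroup φ 1) :
    ∃ N : ℕ, ∀ (t : S), ∀ g ∈ divElemGroup φ (t ^ N), γ * g * γ⁻¹ ∈ divElemGroup φ t := by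
  obtain ⟨q, q', h1, h2, h3, h4, h5⟩ := hq
  have key : ∀ y : Fin (m + 1) → S, y 0 = 0 → (φ *ᵥ y) 0 = 0 →
      toBilin' φ (axisVec φ false) y = 0 ∧ toBilin' φ (axisVec φ true) y = 0 := by
    intro y hy hy'
    refine ⟨?_, by rw [axisVec, cond_true, H.toBilin'_dual, hy]⟩
    rw [axisVec, cond_false, toBilin'_apply', apply_single, hy']
  obtain ⟨g', h6, h7, N, hN⟩ := H.hyperbolic.absorbs_of_mem H.two_mul_half (key q h1 h3)
    (key q' h2 h4) (by rwa [toBilin'_apply']) ((H.mem_divElemGroup_iff 1 γ).1 hγ)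
  refine ⟨N, fun t g hg => ?_⟩
  have hg' : g' = toLin' ((γ⁻¹ : GL (Fin (m + 1)) S) : Matrix (Fin (m + 1)) (Fin (m + 1)) S) := by
    refine left_inv_eq_right_inv h7 ?_
    rw [Module.End.mul_eq_comp, ← Matrix.toLin'_mul, ← Units.val_mul, mul_inv_cancel, Units.val_one,
      Matrix.toLin'_one]
    rfl
  rw [H.mem_divElemGroup_iff] at hg ⊢
  rw [Units.val_mul, Units.val_mul, Matrix.toLin'_mul, Matrix.toLin'_mul, ← hg']
  exact hN t _ hg

theorem elemSymplectic_eq : elemSymplectic φ = divElemGroup φ 1 := by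
  rw [elemSymplectic, divElemGroup]
  congr 1
  ext g
  simp only [Set.mem_ofPred_eq, one_smul]
  constructor
  · rintro ⟨v, h | h⟩
    · exact ⟨true, v, Units.ext (by rw [H.coe_elemGen, h]; rfl)⟩
    · exact ⟨false, v, Units.ext (by rw [H.coe_elemGen, h]; rfl)⟩
  · rintro ⟨b, v, rfl⟩
    refine ⟨v, ?_⟩
    rw [H.coe_elemGen]
    cases b
    · exact Or.inr rfl
    · exact Or.inl rfl

theorem elemGen_mem (b : Bool) (v : Fin m → S) : elemGen φ b v ∈ elemSymplectic φ := by
  rw [H.elemSymplectic_eq]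
  exact Subgroup.subset_closure ⟨b, v, by rw [one_smul]⟩

theorem elemSymplecticIdeal_eq (I : Ideal S) : elemSymplecticIdeal φ I =
    Subgroup.closure {g | ∃ b v, (∀ i, v i ∈ I) ∧ g = elemGen φ b v} := by
  rw [elemSymplecticIdeal]
  congr 1
  ext g
  simp only [Set.mem_ofPred_eq]
  constructor
  · rintro ⟨v, hv, h | h⟩
    · exact ⟨true, v, hv, Units.ext (by rw [H.coe_elemGen, h]; rfl)⟩
    · exact ⟨false, v, hv, Units.ext (by rw [H.coe_elemGen, h]; rfl)⟩
  · rintro ⟨b, v, hv, rfl⟩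
    refine ⟨v, hv, ?_⟩
    rw [H.coe_elemGen]
    cases b
    · exact Or.inr rfl
    · exact Or.inl rfl

omit H in
theorem conj_mem_rel {I : Ideal S} {γ g : GL (Fin (m + 1)) S} (hγ : γ ∈ elemSymplectic φ)
    (hg : g ∈ relElemSymplectic φ I) : γ * g * γ⁻¹ ∈ relElemSymplectic φ I := by
  rw [relElemSymplectic, Subgroup.mem_map] at hg ⊢
  obtain ⟨g, hg, rfl⟩ := hg
  refine ⟨⟨γ, hγ⟩ * g * ⟨γ, hγ⟩⁻¹, Subgroup.normalClosure_normal.conj_mem g hg _, ?_⟩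
  rw [map_mul, map_mul, map_inv]
  rfl

theorem elemGen_mem_rel {I : Ideal S} (b : Bool) {v : Fin m → S} (hv : ∀ i, v i ∈ I) :
    elemGen φ b v ∈ relElemSymplectic φ I := by
  refine ⟨⟨_, H.elemGen_mem b v⟩, Subgroup.subset_normalClosure ?_, rfl⟩
  rw [SetLike.mem_coe, Subgroup.mem_subgroupOf, H.elemSymplecticIdeal_eq]
  exact Subgroup.subset_closure ⟨b, v, hv, rfl⟩

theorem relElemSymplectic_le_of {I : Ideal S} {K : Subgroup (GL (Fin (m + 1)) S)}
    (h1 : ∀ b v, (∀ i, v i ∈ I) → elemGen φ b v ∈ K)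
    (h2 : ∀ γ ∈ elemSymplectic φ, ∀ g ∈ K, γ * g * γ⁻¹ ∈ K) : relElemSymplectic φ I ≤ K := by
  rw [relElemSymplectic, Subgroup.map_le_iff_le_comap]
  have : (K.comap (elemSymplectic φ).subtype).Normal := ⟨fun g hg γ => h2 γ γ.2 g hg⟩
  refine Subgroup.normalClosure_le_normal ?_
  intro g hg
  have hg' : (g : GL (Fin (m + 1)) S) ∈ elemSymplecticIdeal φ I := hg
  have hle : elemSymplecticIdeal φ I ≤ K := by
    rw [H.elemSymplecticIdeal_eq, Subgroup.closure_le]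
    rintro _ ⟨b, v, hv, rfl⟩
    exact h1 b v hv
  exact hle hg'

theorem elemGen_add_mul_inv_mem {I : Ideal S} (b : Bool) (v : Fin m → S) {w : Fin m → S}
    (hw : ∀ i, w i ∈ I) : elemGen φ b (v + w) * (elemGen φ b v)⁻¹ ∈ relElemSymplectic φ I := by
  obtain ⟨u, hu, hJ⟩ := H.exists_elemGen_mul b v w 1
  rw [one_smul, one_smul] at hu
  rw [hu]
  exact conj_mem_rel (H.elemGen_mem b v) (H.elemGen_mem_rel b (hJ I hw))

/-! ### Functoriality -/

variable {T : Type*} [CommRing T] (f : S →+* T)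

theorem map : IsSymplecticForm (φ.map f) where
  skew := by rw [← Matrix.transpose_map, H.skew]; ext; simp
  det := by
    have := H.det.map f
    rwa [RingHom.map_det] at this
  two := by
    have := H.two.map f
    rwa [map_ofNat] at this

theorem map_nonsing_inv : (φ.map f)⁻¹ = φ⁻¹.map f := by
  refine Matrix.inv_eq_left_inv ?_
  rw [← Matrix.map_mul, Matrix.nonsing_inv_mul _ H.det, Matrix.map_one _ (map_zero f) (map_one f)]

theorem map_elemGen (b : Bool) (v : Fin m → S) :
    Matrix.GeneralLinearGroup.map f (elemGen φ b v) = elemGen (φ.map f) b (f ∘ v) := by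
  ext i j
  rw [Matrix.GeneralLinearGroup.map_apply, H.coe_elemGen, (H.map f).coe_elemGen]
  cases b <;> refine Fin.cases ?_ (fun i => ?_) i <;> refine Fin.cases ?_ (fun j => ?_) j <;>
    simp [vasersteinMatrix, vasersteinR, vasersteinC, vasersteinAlpha, vasersteinBeta, H.map_nonsing_inv,
      Matrix.mul_apply, vecMulVec_apply, Matrix.one_apply, apply_ite f]

theorem map_mem_elemSymplectic {g : GL (Fin (m + 1)) S} (hg : g ∈ elemSymplectic φ) :
    Matrix.GeneralLinearGroup.map f g ∈ elemSymplectic (φ.map f) := by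
  suffices elemSymplectic φ ≤
      (elemSymplectic (φ.map f)).comap (Matrix.GeneralLinearGroup.map f) from this hg
  rw [H.elemSymplectic_eq, divElemGroup, Subgroup.closure_le]
  rintro _ ⟨b, v, rfl⟩
  rw [SetLike.mem_coe, Subgroup.mem_comap, H.map_elemGen]
  exact (H.map f).elemGen_mem _ _

theorem map_mem_relElemSymplectic {I : Ideal S} {J : Ideal T} (hIJ : ∀ a ∈ I, f a ∈ J)
    {g : GL (Fin (m + 1)) S} (hg : g ∈ relElemSymplectic φ I) :
    Matrix.GeneralLinearGroup.map f g ∈ relElemSymplectic (φ.map f) J := by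
  suffices relElemSymplectic φ I ≤
      (relElemSymplectic (φ.map f) J).comap (Matrix.GeneralLinearGroup.map f) from this hg
  refine H.relElemSymplectic_le_of (fun b v hv => ?_) (fun γ hγ g hg => ?_)
  · rw [Subgroup.mem_comap, H.map_elemGen]
    exact (H.map f).elemGen_mem_rel b fun i => hIJ _ (hv i)
  · rw [Subgroup.mem_comap, map_mul, map_mul, map_inv]
    exact conj_mem_rel (H.map_mem_elemSymplectic f hγ) hg

end IsSymplecticForm

end ElementaryGroup

/-! ### Relative elements as absolute elements over the ring of congruent pairs. -/

section PairRing

variable {S : Type*} [CommRing S]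

/-- The ring of pairs of elements of `S` which are congruent modulo `J`. -/
def pairSubring (J : Ideal S) : Subring (S × S) :=
  RingHom.eqLocus ((Ideal.Quotient.mk J).comp (RingHom.fst S S))
    ((Ideal.Quotient.mk J).comp (RingHom.snd S S))

theorem mem_pairSubring {J : Ideal S} {p : S × S} : p ∈ pairSubring J ↔ p.1 - p.2 ∈ J := by
  rw [← Ideal.Quotient.eq]; rfl

/-- The first projection. -/
def pairFst (J : Ideal S) : pairSubring J →+* S := (RingHom.fst S S).comp (pairSubring J).subtype

/-- The second projection. -/
def pairSnd (J : Ideal S) : pairSubring J →+* S := (RingHom.snd S S).comp (pairSubring J).subtype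

/-- The diagonal embedding. -/
def pairDiag (J : Ideal S) : S →+* pairSubring J :=
  ((RingHom.id S).prod (RingHom.id S)).codRestrict (pairSubring J)
    (fun s => mem_pairSubring.2 (by simp))

/-- The endomorphism of the ring of pairs given by an endomorphism of `S` preserving `J`. -/
def pairMap {J : Ideal S} (f : S →+* S) (hf : ∀ a ∈ J, f a ∈ J) :
    pairSubring J →+* pairSubring J :=
  ((f.comp (pairFst J)).prod (f.comp (pairSnd J))).codRestrict (pairSubring J)
    (fun p => mem_pairSubring.2 (by
      have := hf _ (mem_pairSubring.1 p.2)
      rwa [map_sub] at this))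

variable {J : Ideal S}

@[simp] theorem pairFst_diag (s : S) : pairFst J (pairDiag J s) = s := rfl
@[simp] theorem pairSnd_diag (s : S) : pairSnd J (pairDiag J s) = s := rfl

theorem pair_ext {p q : pairSubring J} (h1 : pairFst J p = pairFst J q)
    (h2 : pairSnd J p = pairSnd J q) : p = q := Subtype.ext (Prod.ext h1 h2)

@[simp] theorem pairFst_map (f : S →+* S) (hf : ∀ a ∈ J, f a ∈ J) (p : pairSubring J) :
    pairFst J (pairMap f hf p) = f (pairFst J p) := rfl
@[simp] theorem pairSnd_map (f : S →+* S) (hf : ∀ a ∈ J, f a ∈ J) (p : pairSubring J) :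
    pairSnd J (pairMap f hf p) = f (pairSnd J p) := rfl

theorem pair_sub_mem (p : pairSubring J) : pairSnd J p - pairFst J p ∈ J := by
  rw [← neg_sub]
  exact neg_mem (mem_pairSubring.1 p.2)

variable {m : ℕ}

theorem GL_map_map {R S T : Type*} [CommRing R] [CommRing S] [CommRing T] (f : S →+* T)
    (g : R →+* S) (x : GL (Fin m) R) :
    Matrix.GeneralLinearGroup.map f (Matrix.GeneralLinearGroup.map g x) =
      Matrix.GeneralLinearGroup.map (f.comp g) x := by
  ext; simp

theorem GL_map_congr {R S : Type*} [CommRing R] [CommRing S] {f g : R →+* S} (h : ∀ x, f x = g x)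
    (x : GL (Fin m) R) :
    Matrix.GeneralLinearGroup.map f x = Matrix.GeneralLinearGroup.map g x := by
  ext; simp [h]

theorem GL_pair_ext {x y : GL (Fin m) (pairSubring J)}
    (h1 : Matrix.GeneralLinearGroup.map (pairFst J) x = Matrix.GeneralLinearGroup.map (pairFst J) y)
    (h2 : Matrix.GeneralLinearGroup.map (pairSnd J) x =
      Matrix.GeneralLinearGroup.map (pairSnd J) y) : x = y := by
  refine Matrix.GeneralLinearGroup.ext fun i j => pair_ext ?_ ?_
  · simpa using congrArg (fun g : GL (Fin m) S => g i j) h1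
  · simpa using congrArg (fun g : GL (Fin m) S => g i j) h2

/-- A generator with parameter `v` in `J` lifts to the parameter `(0, v)`, and conjugating elements
lift diagonally. -/
theorem IsSymplecticForm.exists_pair_lift {φ : Matrix (Fin (m + 1)) (Fin (m + 1)) S}
    (H : IsSymplecticForm φ) {σ : GL (Fin (m + 1)) S} (hσ : σ ∈ relElemSymplectic φ J) :
    ∃ τ ∈ elemSymplectic (φ.map (pairDiag J)),
      Matrix.GeneralLinearGroup.map (pairFst J) τ = 1 ∧
      Matrix.GeneralLinearGroup.map (pairSnd J) τ = σ := by
  let K : Subgroup (GL (Fin (m + 1)) S) :=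
    ((elemSymplectic (φ.map (pairDiag J))) ⊓
      (Matrix.GeneralLinearGroup.map (pairFst J)).ker).map
        (Matrix.GeneralLinearGroup.map (pairSnd J))
  suffices relElemSymplectic φ J ≤ K by
    obtain ⟨τ, h12, h3⟩ := Subgroup.mem_map.1 (this hσ)
    obtain ⟨h1, h2⟩ := Subgroup.mem_inf.1 h12
    exact ⟨τ, h1, h2, h3⟩
  have HD := H.map (pairDiag J)
  have e1 : (φ.map (pairDiag J)).map (pairFst J) = φ := by ext; simp
  have e2 : (φ.map (pairDiag J)).map (pairSnd J) = φ := by ext; simp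
  refine H.relElemSymplectic_le_of (fun b v hv => ?_) ?_
  · let w : Fin m → pairSubring J := fun i => ⟨(0, v i), mem_pairSubring.2 (by simpa using hv i)⟩
    have w1 : pairFst J ∘ w = 0 := rfl
    have w2 : pairSnd J ∘ w = v := rfl
    refine Subgroup.mem_map.2 ⟨elemGen _ b w,
      Subgroup.mem_inf.2 ⟨HD.elemGen_mem b w, MonoidHom.mem_ker.2 ?_⟩, ?_⟩
    · rw [HD.map_elemGen, e1, w1, H.elemGen_zero]
    · rw [HD.map_elemGen, e2, w2]
  · intro γ hγ _ hK
    obtain ⟨τ, h12, rfl⟩ := Subgroup.mem_map.1 hK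
    obtain ⟨h1, h2⟩ := Subgroup.mem_inf.1 h12
    have hd := H.map_mem_elemSymplectic (pairDiag J) hγ
    refine Subgroup.mem_map.2 ⟨Matrix.GeneralLinearGroup.map (pairDiag J) γ * τ *
      (Matrix.GeneralLinearGroup.map (pairDiag J) γ)⁻¹,
      Subgroup.mem_inf.2 ⟨mul_mem (mul_mem hd h1) (inv_mem hd), MonoidHom.mem_ker.2 ?_⟩, ?_⟩
    · rw [MonoidHom.mem_ker] at h2
      rw [map_mul, map_mul, h2, map_inv, mul_one, mul_inv_cancel]
    · rw [map_mul, map_mul, map_inv, GL_map_map]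
      have : Matrix.GeneralLinearGroup.map ((pairSnd J).comp (pairDiag J)) γ = γ := by ext; simp
      rw [this]

end PairRing

/-! ### Elementary elements that specialize to `1`, and substitution of powers. -/

section Constants

variable {D : Type*} [CommRing D] {m : ℕ} {φ : Matrix (Fin (m + 1)) (Fin (m + 1)) D}

/-- Given an endomorphism `ε` of the ground ring which is congruent to the identity modulo `z`,
an elementary element `g` is the product of its image under `ε` and conjugates by such images of
generators divisible by `z`. -/
theorem IsSymplecticForm.mul_map_inv_mem (H : IsSymplecticForm φ) {ε : D →+* D}
    (hε : φ.map ε = φ) (hεε : ∀ a, ε (ε a) = ε a) {z : D} (hz : ∀ a, ∃ b, a = ε a + z * b)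
    {g : GL (Fin (m + 1)) D} (hg : g ∈ elemSymplectic φ) :
    g * (Matrix.GeneralLinearGroup.map ε g)⁻¹ ∈ Subgroup.closure
      {x | ∃ γ ∈ elemSymplectic φ, Matrix.GeneralLinearGroup.map ε γ = γ ∧
        ∃ b v, x = γ * elemGen φ b (z • v) * γ⁻¹} := by
  set N := Subgroup.closure
      {x | ∃ γ ∈ elemSymplectic φ, Matrix.GeneralLinearGroup.map ε γ = γ ∧
        ∃ b v, x = γ * elemGen φ b (z • v) * γ⁻¹} with hN
  have hmap : ∀ γ ∈ elemSymplectic φ, Matrix.GeneralLinearGroup.map ε γ ∈ elemSymplectic φ :=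
    fun γ hγ => by simpa only [hε] using H.map_mem_elemSymplectic ε hγ
  have hmm : ∀ γ : GL (Fin (m + 1)) D, Matrix.GeneralLinearGroup.map ε
      (Matrix.GeneralLinearGroup.map ε γ) = Matrix.GeneralLinearGroup.map ε γ := fun γ => by
    ext; simp [hεε]
  -- Needed for products: `xy ε(xy)⁻¹` is `x ε(x)⁻¹` times the conjugate of `y ε(y)⁻¹` by `ε(x)`.
  have hnorm : ∀ γ ∈ elemSymplectic φ, Matrix.GeneralLinearGroup.map ε γ = γ →
      ∀ x ∈ N, γ * x * γ⁻¹ ∈ N := by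
    intro γ hγ hγε x hx
    have : N ≤ N.comap (MulAut.conj γ).toMonoidHom := by
      rw [hN, Subgroup.closure_le]
      rintro _ ⟨δ, hδ, hδε, b, v, rfl⟩
      refine Subgroup.subset_closure ⟨γ * δ, mul_mem hγ hδ, by rw [map_mul, hγε, hδε], b, v, ?_⟩
      simp only [MulEquiv.toMonoidHom_eq_coe, MonoidHom.coe_coe, MulAut.conj_apply]
      group
    exact this hx
  have hg' := hg
  rw [H.elemSymplectic_eq, divElemGroup] at hg'
  induction hg' using Subgroup.closure_induction with
  | mem x hx =>
    obtain ⟨b, v, rfl⟩ := hx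
    rw [one_smul]
    choose w hw using fun i => hz (v i)
    obtain ⟨u, hu, -⟩ := H.exists_elemGen_mul b (ε ∘ v) w z
    have hv : v = ε ∘ v + z • w := funext hw
    have hmg : Matrix.GeneralLinearGroup.map ε (elemGen φ b v) = elemGen φ b (ε ∘ v) := by
      rw [H.map_elemGen, hε]
    rw [hmg]
    nth_rw 1 [hv]
    rw [hu]
    refine Subgroup.subset_closure ⟨_, H.elemGen_mem b (ε ∘ v), ?_, b, u, rfl⟩
    rw [← hmg, hmm]
  | one => simp
  | mul x y hx hy ihx ihy =>
    rw [← divElemGroup, ← H.elemSymplectic_eq] at hx hy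
    have h1 := hnorm _ (hmap x hx) (hmm x) _ (ihy hy)
    have h2 := mul_mem (ihx hx) h1
    convert h2 using 1
    rw [map_mul]
    group
  | inv x hx ihx =>
    rw [← divElemGroup, ← H.elemSymplectic_eq] at hx
    have h1 := hnorm _ (inv_mem (hmap x hx)) (by rw [map_inv, hmm]) _ (inv_mem (ihx hx))
    convert h1 using 1
    rw [map_inv]
    group

/-- In the application `z` is `X`, `ε` sets `X = 0` and `h n` is `X ↦ X ^ n`. The map `h n` fixes
the constant conjugators and makes the generators divisible by `z ^ n`, which absorption handles for
large `n`. -/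
theorem IsSymplecticForm.exists_map_mem_divElemGroup (H : IsSymplecticForm φ)
    (hq : HasOrthogonalPair φ) {ε : D →+* D} (hε : φ.map ε = φ) (hεε : ∀ a, ε (ε a) = ε a) {z : D}
    (hz : ∀ a, ∃ b, a = ε a + z * b) {h : ℕ → D →+* D} (hφ : ∀ n, φ.map (h n) = φ)
    (hhε : ∀ n a, h n (ε a) = ε a) (hhz : ∀ n, h n z = z ^ n)
    {g : GL (Fin (m + 1)) D} (hg : g ∈ elemSymplectic φ)
    (hg1 : Matrix.GeneralLinearGroup.map ε g = 1) :
    ∃ N, ∀ n, N ≤ n → Matrix.GeneralLinearGroup.map (h n) g ∈ divElemGroup φ z := by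
  have hmem := H.mul_map_inv_mem hε hεε hz hg
  rw [hg1, inv_one, mul_one] at hmem
  clear hg hg1
  induction hmem using Subgroup.closure_induction with
  | mem x hx =>
    obtain ⟨γ, hγ, hγε, b, v, rfl⟩ := hx
    obtain ⟨N, hN⟩ := H.exists_conj_mem hq (by rwa [← H.elemSymplectic_eq])
    refine ⟨N, fun n hn => ?_⟩
    have hγn : Matrix.GeneralLinearGroup.map (h n) γ = γ := by
      rw [← hγε]; ext; simp [hhε]
    have hv : h n ∘ (z • v) = z ^ n • (h n ∘ v) := by ext i; simp [hhz]
    rw [map_mul, map_mul, map_inv, hγn, H.map_elemGen, hφ, hv]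
    exact hN z _ (IsSymplecticForm.divElemGroup_mono (pow_dvd_pow z hn)
      (IsSymplecticForm.elemGen_mem_divElemGroup _ _ _))
  | one => exact ⟨0, fun n _ => by rw [map_one]; exact one_mem _⟩
  | mul x y _ _ hx hy =>
    obtain ⟨N, hN⟩ := hx
    obtain ⟨K, hK⟩ := hy
    refine ⟨max N K, fun n hn => ?_⟩
    rw [map_mul]
    exact mul_mem (hN n (le_of_max_le_left hn)) (hK n (le_of_max_le_right hn))
  | inv x _ hx =>
    obtain ⟨N, hN⟩ := hx
    exact ⟨N, fun n hn => by rw [map_inv]; exact inv_mem (hN n hn)⟩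

end Constants

/-! ### The dilation principle: clearing denominators and torsion. -/

section Dilation

variable {A B : Type*} [CommRing A] [CommRing B]

theorem comp_mem_map_C {I : Ideal A} (q : A[X]) {p : A[X]} (hp : p ∈ I.map (C : A →+* A[X])) :
    p.comp q ∈ I.map (C : A →+* A[X]) := by
  suffices I.map (C : A →+* A[X]) ≤ (I.map (C : A →+* A[X])).comap (compRingHom q) from this hp
  rw [Ideal.map_le_iff_le_comap]
  intro a ha
  rw [Ideal.mem_comap, Ideal.mem_comap, coe_compRingHom]
  simpa using Ideal.mem_map_of_mem C ha

variable [Algebra A B] (M : Submonoid A) [IsLocalization M B]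
include M

/-- The factor `X` becomes `sX`, and this `s` cancels a common denominator of `p`. Stating it for
all multiples of `s₀` lets finitely many conditions be combined. -/
theorem exists_clear_denominators {I : Ideal A} {p : B[X]}
    (hp : p ∈ (I.map (algebraMap A B)).map (C : B →+* B[X])) :
    ∃ s₀ ∈ M, ∀ s, s₀ ∣ s → ∃ p' ∈ I.map (C : A →+* A[X]),
      (X * p').map (algebraMap A B) = (X * p).comp (C (algebraMap A B s) * X) := by
  let _ : Algebra A[X] B[X] := Polynomial.algebra A B
  have : IsLocalization (M.map (C : A →+* A[X])) B[X] := Polynomial.isLocalization M B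
  have hp' : p ∈ (I.map (C : A →+* A[X])).map (algebraMap A[X] B[X]) := by
    have hcomp : (algebraMap A[X] B[X]).comp C = C.comp (algebraMap A B) := by
      ext a; simp [Polynomial.algebraMap_def]
    rwa [Ideal.map_map, hcomp, ← Ideal.map_map]
  obtain ⟨⟨⟨p₀, hp₀⟩, ⟨_, c, hc, rfl⟩⟩, h⟩ :=
    (IsLocalization.mem_map_algebraMap_iff (M.map (C : A →+* A[X])) B[X]).1 hp'
  simp only [Polynomial.algebraMap_def, coe_mapRingHom, map_C] at h
  refine ⟨c, hc, ?_⟩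
  rintro _ ⟨r, rfl⟩
  refine ⟨C r * p₀.comp (C (c * r) * X), Ideal.mul_mem_left _ _ (comp_mem_map_C _ hp₀), ?_⟩
  simp only [Polynomial.map_mul, map_X, map_C, map_comp, mul_comp, X_comp, ← h, C_comp, map_mul]
  ring

/-- Write `p = X q`; some `c` in `M` kills `q`, and at a multiple `s` of `c` the factor `X` supplies
that `c`. -/
theorem exists_eval_eq_zero {p : A[X]} (h0 : p.eval 0 = 0) (hp : p.map (algebraMap A B) = 0) :
    ∃ s₀ ∈ M, ∀ s, s₀ ∣ s → p.eval s = 0 := by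
  let _ : Algebra A[X] B[X] := Polynomial.algebra A B
  have : IsLocalization (M.map (C : A →+* A[X])) B[X] := Polynomial.isLocalization M B
  obtain ⟨q, rfl⟩ : X ∣ p := by rwa [X_dvd_iff, coeff_zero_eq_eval_zero]
  have hq : algebraMap A[X] B[X] q = 0 := by
    rw [Polynomial.map_mul, map_X] at hp
    ext n
    simpa [Polynomial.algebraMap_def] using congrArg (fun r => r.coeff (n + 1)) hp
  obtain ⟨⟨_, c, hc, rfl⟩, h⟩ := (IsLocalization.map_eq_zero_iff (M.map (C : A →+* A[X])) B[X] q).1 hq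
  refine ⟨c, hc, ?_⟩
  rintro _ ⟨r, rfl⟩
  have := congrArg (eval (c * r)) h
  simp only [eval_mul, eval_C, eval_X, eval_zero] at this ⊢
  linear_combination r * this

theorem exists_common_multiple {ι : Type*} [Fintype ι] {P : ι → A → Prop}
    (h : ∀ i, ∃ s₀ ∈ M, ∀ s, s₀ ∣ s → P i s) : ∃ s₀ ∈ M, ∀ s, s₀ ∣ s → ∀ i, P i s := by
  choose f hf hP using h
  exact ⟨∏ i, f i, prod_mem fun i _ => hf i, fun s hs i =>
    hP i s ((Finset.dvd_prod_of_mem f (Finset.mem_univ i)).trans hs)⟩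

variable {m : ℕ}

theorem exists_map_eval_eq {α β : GL (Fin m) A[X]}
    (h0 : Matrix.GeneralLinearGroup.map (evalRingHom 0) α =
      Matrix.GeneralLinearGroup.map (evalRingHom 0) β)
    (h : Matrix.GeneralLinearGroup.map (mapRingHom (algebraMap A B)) α =
      Matrix.GeneralLinearGroup.map (mapRingHom (algebraMap A B)) β) :
    ∃ s₀ ∈ M, ∀ s, s₀ ∣ s → Matrix.GeneralLinearGroup.map (evalRingHom s) α =
      Matrix.GeneralLinearGroup.map (evalRingHom s) β := by
  have key : ∀ ij : Fin m × Fin m, ∃ s₀ ∈ M, ∀ s, s₀ ∣ s →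
      (α ij.1 ij.2 - β ij.1 ij.2).eval s = 0 := by
    rintro ⟨i, j⟩
    refine exists_eval_eq_zero (B := B) M ?_ ?_
    · have := congrArg (fun g : GL (Fin m) A => g i j) h0
      simp only [GeneralLinearGroup.map_apply, coe_evalRingHom] at this
      rw [eval_sub, this, sub_self]
    · have := congrArg (fun g : GL (Fin m) B[X] => g i j) h
      simp only [GeneralLinearGroup.map_apply, coe_mapRingHom] at this
      rw [Polynomial.map_sub, this, sub_self]
  obtain ⟨s₀, hs₀, hs⟩ := exists_common_multiple M key
  refine ⟨s₀, hs₀, fun s hss => Matrix.GeneralLinearGroup.ext fun i j => ?_⟩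
  have := hs s hss (i, j)
  rw [eval_sub, sub_eq_zero] at this
  simpa using this

theorem exists_lift_of_mem_divElemGroup {φ : Matrix (Fin (m + 1)) (Fin (m + 1)) A}
    (H : IsSymplecticForm φ) (I : Ideal A) {J : Ideal B[X]}
    (hJ : J = (I.map (algebraMap A B)).map (C : B →+* B[X]))
    {g : GL (Fin (m + 1)) (pairSubring J)}
    (hg : g ∈ divElemGroup (((φ.map (algebraMap A B)).map (C : B →+* B[X])).map (pairDiag J))
      (pairDiag J X)) :
    ∃ s₀ ∈ M, ∀ s, s₀ ∣ s → ∃ β₁ β₂ : GL (Fin (m + 1)) A[X],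
      β₁ ∈ elemSymplectic (φ.map (C : A →+* A[X])) ∧
      β₂ * β₁⁻¹ ∈ relElemSymplectic (φ.map (C : A →+* A[X])) (I.map (C : A →+* A[X])) ∧
      (Matrix.GeneralLinearGroup.map (evalRingHom 0) β₁ = 1 ∧
        Matrix.GeneralLinearGroup.map (evalRingHom 0) β₂ = 1) ∧
      Matrix.GeneralLinearGroup.map (mapRingHom (algebraMap A B)) β₁ =
        Matrix.GeneralLinearGroup.map (compRingHom (C (algebraMap A B s) * X))
          (Matrix.GeneralLinearGroup.map (pairFst J) g) ∧
      Matrix.GeneralLinearGroup.map (mapRingHom (algebraMap A B)) β₂ =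
        Matrix.GeneralLinearGroup.map (compRingHom (C (algebraMap A B s) * X))
          (Matrix.GeneralLinearGroup.map (pairSnd J) g) := by
  have HC := H.map (C : A →+* A[X])
  have HX := (H.map (algebraMap A B)).map (C : B →+* B[X])
  have HD := HX.map (pairDiag J)
  have e0 : (φ.map (C : A →+* A[X])).map (evalRingHom 0) = φ := by ext; simp
  have e1 : (φ.map (C : A →+* A[X])).map (mapRingHom (algebraMap A B)) =
    (φ.map (algebraMap A B)).map (C : B →+* B[X]) := by ext; simp
  have e2 : (((φ.map (algebraMap A B)).map (C : B →+* B[X])).map (pairDiag J)).map (pairFst J) =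
    (φ.map (algebraMap A B)).map (C : B →+* B[X]) := by ext; simp
  have e3 : (((φ.map (algebraMap A B)).map (C : B →+* B[X])).map (pairDiag J)).map (pairSnd J) =
    (φ.map (algebraMap A B)).map (C : B →+* B[X]) := by ext; simp
  have e4 : ∀ s : A, ((φ.map (algebraMap A B)).map (C : B →+* B[X])).map
      (compRingHom (C (algebraMap A B s) * X)) =
    (φ.map (algebraMap A B)).map (C : B →+* B[X]) := by intro s; ext; simp
  induction hg using Subgroup.closure_induction with
  | mem x hx =>
    obtain ⟨b, v, rfl⟩ := hx
    have h1 : ∀ i, ∃ s₀ ∈ M, ∀ s, s₀ ∣ s → ∃ p' : A[X],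
        (X * p').map (algebraMap A B) =
          (X * pairFst J (v i)).comp (C (algebraMap A B s) * X) := by
      intro i
      have : pairFst J (v i) ∈ ((⊤ : Ideal A).map (algebraMap A B)).map (C : B →+* B[X]) := by
        rw [Ideal.map_top, Ideal.map_top]; trivial
      obtain ⟨s₀, hs₀, h⟩ := exists_clear_denominators M this
      exact ⟨s₀, hs₀, fun s hs => (h s hs).imp fun p hp => hp.2⟩
    have h2 : ∀ i, ∃ s₀ ∈ M, ∀ s, s₀ ∣ s → ∃ p' ∈ I.map (C : A →+* A[X]),
        (X * p').map (algebraMap A B) =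
          (X * (pairSnd J (v i) - pairFst J (v i))).comp (C (algebraMap A B s) * X) :=
      fun i => exists_clear_denominators M (hJ ▸ pair_sub_mem (v i))
    obtain ⟨s₁, hs₁, h1⟩ := exists_common_multiple M h1
    obtain ⟨s₂, hs₂, h2⟩ := exists_common_multiple M h2
    refine ⟨s₁ * s₂, mul_mem hs₁ hs₂, fun s hs => ?_⟩
    choose a ha using h1 s ((dvd_mul_right _ _).trans hs)
    choose d hdI hd using h2 s ((dvd_mul_left _ _).trans hs)
    have hz : ∀ a : Fin m → A[X], (evalRingHom 0 : A[X] →+* A) ∘ ((X : A[X]) • a) = 0 := by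
      intro a; ext i; simp
    -- The first component and the difference of components are lifted separately, so the two
    -- parameters stay congruent modulo `I`.
    refine ⟨elemGen _ b ((X : A[X]) • a), elemGen _ b ((X : A[X]) • a + (X : A[X]) • d),
      HC.elemGen_mem _ _, HC.elemGen_add_mul_inv_mem b _ fun i => Ideal.mul_mem_left _ _ (hdI i),
      ⟨?_, ?_⟩, ?_, ?_⟩
    · rw [HC.map_elemGen, e0, hz, H.elemGen_zero]
    · rw [← smul_add, HC.map_elemGen, e0, hz, H.elemGen_zero]
    · rw [HC.map_elemGen, e1, HD.map_elemGen, e2, HX.map_elemGen, e4]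
      congr 1
      funext i
      simpa using ha i
    · rw [HC.map_elemGen, e1, HD.map_elemGen, e3, HX.map_elemGen, e4]
      congr 1
      funext i
      have := congrArg₂ (· + ·) (ha i) (hd i)
      simp only [← add_comp, ← Polynomial.map_add, ← mul_add, add_sub_cancel] at this
      rw [mul_add] at this
      simpa using this
  | one =>
    refine ⟨1, one_mem M, fun s _ => ⟨1, 1, one_mem _, ?_, ?_, ?_, ?_⟩⟩
    · rw [inv_one, mul_one]; exact one_mem _
    · simp
    · simp
    · simp
  | mul x y _ _ hx hy =>
    obtain ⟨s₁, hs₁, h1⟩ := hx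
    obtain ⟨s₂, hs₂, h2⟩ := hy
    refine ⟨s₁ * s₂, mul_mem hs₁ hs₂, fun s hs => ?_⟩
    obtain ⟨β₁, β₂, a1, a2, a3, a4, a5⟩ := h1 s ((dvd_mul_right _ _).trans hs)
    obtain ⟨δ₁, δ₂, b1, b2, b3, b4, b5⟩ := h2 s ((dvd_mul_left _ _).trans hs)
    refine ⟨β₁ * δ₁, β₂ * δ₂, mul_mem a1 b1, ?_, ?_, ?_, ?_⟩
    · have := mul_mem a2 (IsSymplecticForm.conj_mem_rel a1 b2)
      convert this using 1
      group
    · simp [a3, b3]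
    · simp only [map_mul, a4, b4]
    · simp only [map_mul, a5, b5]
  | inv x _ hx =>
    obtain ⟨s₁, hs₁, h1⟩ := hx
    refine ⟨s₁, hs₁, fun s hs => ?_⟩
    obtain ⟨β₁, β₂, a1, a2, a3, a4, a5⟩ := h1 s hs
    refine ⟨β₁⁻¹, β₂⁻¹, inv_mem a1, ?_, ?_, ?_, ?_⟩
    · have := IsSymplecticForm.conj_mem_rel (inv_mem a1) (inv_mem a2)
      convert this using 1
      group
    · simp [a3]
    · simp only [map_inv, a4]
    · simp only [map_inv, a5]

/-- If a matrix polynomial which is `1` at `0` becomes relatively elementary over a localization,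
then its value at some element of the multiplicative set is relatively elementary. -/
theorem IsSymplecticForm.exists_eval_mem {φ : Matrix (Fin (m + 1)) (Fin (m + 1)) A}
    (H : IsSymplecticForm φ) (hq : HasOrthogonalPair (φ.map (algebraMap A B))) (I : Ideal A)
    {σ : GL (Fin (m + 1)) A[X]} (h0 : Matrix.GeneralLinearGroup.map (evalRingHom 0) σ = 1)
    (hσ : Matrix.GeneralLinearGroup.map (mapRingHom (algebraMap A B)) σ ∈
      relElemSymplectic ((φ.map (algebraMap A B)).map (C : B →+* B[X]))
        ((I.map (algebraMap A B)).map (C : B →+* B[X]))) :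
    ∃ s ∈ M, Matrix.GeneralLinearGroup.map (evalRingHom s) σ ∈ relElemSymplectic φ I := by
  set J : Ideal B[X] := (I.map (algebraMap A B)).map (C : B →+* B[X]) with hJ
  have HC := H.map (C : A →+* A[X])
  have HX := (H.map (algebraMap A B)).map (C : B →+* B[X])
  have HD := HX.map (pairDiag J)
  obtain ⟨τ, hτ, hτ1, hτ2⟩ := HX.exists_pair_lift hσ
  have hcJ : ∀ q : B[X], ∀ a ∈ J, compRingHom q a ∈ J := fun q a ha => comp_mem_map_C q ha
  have hDmap : ∀ q : B[X], (((φ.map (algebraMap A B)).map (C : B →+* B[X])).map (pairDiag J)).map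
      (pairMap (compRingHom q) (hcJ q)) =
        ((φ.map (algebraMap A B)).map (C : B →+* B[X])).map (pairDiag J) := by
    exact fun q => Matrix.ext fun i j => pair_ext (by simp) (by simp)
  have hτ0 : Matrix.GeneralLinearGroup.map (pairMap (compRingHom 0) (hcJ 0)) τ = 1 := by
    refine GL_pair_ext ?_ ?_
    · have := congrArg (Matrix.GeneralLinearGroup.map (compRingHom (0 : B[X]))) hτ1
      rw [map_one, GL_map_map] at this
      rw [GL_map_map, map_one, ← this]
      rfl
    · have h2 := congrArg (Matrix.GeneralLinearGroup.map (compRingHom (0 : B[X]))) hτ2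
      have h3 := congrArg (Matrix.GeneralLinearGroup.map (C.comp (algebraMap A B))) h0
      rw [map_one, GL_map_map] at h3
      rw [GL_map_map, GL_map_map] at h2
      rw [GL_map_map, map_one, ← h3]
      refine Eq.trans h2 (GL_map_congr (fun p => ?_) σ)
      change (p.map (algebraMap A B)).comp 0 = C (algebraMap A B (p.eval 0))
      rw [comp_zero, eval_zero_map]
  have hz : ∀ a, ∃ b, a = pairMap (compRingHom 0) (hcJ 0) a + pairDiag J X * b := by
    intro a
    have hdiv : ∀ p : B[X], p = p.comp 0 + X * p.divX := fun p => by
      rw [comp_zero, ← coeff_zero_eq_eval_zero, add_comm, X_mul_divX_add]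
    refine ⟨⟨((pairFst J a).divX, (pairSnd J a).divX), mem_pairSubring.2 ?_⟩,
      pair_ext (hdiv (pairFst J a)) (hdiv (pairSnd J a))⟩
    have hX : ∀ p ∈ J, p.divX ∈ J := by
      rw [hJ]
      intro p hp
      rw [Ideal.mem_map_C_iff] at hp ⊢
      intro n
      rw [coeff_divX]
      exact hp (n + 1)
    have hsub : ∀ p q : B[X], p.divX - q.divX = (p - q).divX := fun p q => by ext; simp
    rw [hsub]
    exact hX _ (mem_pairSubring.1 a.2)
  obtain ⟨N, hN⟩ := HD.exists_map_mem_divElemGroup ((hq.map C).map (pairDiag J)) (hDmap 0)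
    (fun a => pair_ext (by simp) (by simp)) hz
    (h := fun n => pairMap (compRingHom (X ^ n)) (hcJ _)) (fun n => hDmap _)
    (fun n a => pair_ext (by simp) (by simp)) (fun n => pair_ext (by simp) (by simp)) hτ hτ0
  -- The exponent `N + 1` is positive, so `X ↦ X ^ (N + 1)` still sends `0` to `0`.
  obtain ⟨s, hsM, hs⟩ := exists_lift_of_mem_divElemGroup M H I hJ (hN (N + 1) N.le_succ)
  obtain ⟨β₁, β₂, h1, h2, ⟨h3, h4⟩, h5, h6⟩ := hs s dvd_rfl
  set α := Matrix.GeneralLinearGroup.map (compRingHom ((C s * X) ^ (N + 1))) σ with hα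
  have hα0 : Matrix.GeneralLinearGroup.map (evalRingHom 0) α = 1 := by
    rw [hα, GL_map_map, ← h0]
    exact GL_map_congr (fun p => by simp [eval_comp]) σ
  have hβ₁ : Matrix.GeneralLinearGroup.map (mapRingHom (algebraMap A B)) β₁ =
      Matrix.GeneralLinearGroup.map (mapRingHom (algebraMap A B)) 1 := by
    rw [h5, GL_map_map (pairFst J)]
    have : (pairFst J).comp (pairMap (compRingHom (X ^ (N + 1))) (hcJ _)) =
      (compRingHom (X ^ (N + 1))).comp (pairFst J) := rfl
    rw [this, ← GL_map_map, hτ1, map_one, map_one, map_one]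
  have hβ₂ : Matrix.GeneralLinearGroup.map (mapRingHom (algebraMap A B)) β₂ =
      Matrix.GeneralLinearGroup.map (mapRingHom (algebraMap A B)) α := by
    rw [h6, GL_map_map (pairSnd J)]
    have : (pairSnd J).comp (pairMap (compRingHom (X ^ (N + 1))) (hcJ _)) =
      (compRingHom (X ^ (N + 1))).comp (pairSnd J) := rfl
    rw [this, ← GL_map_map, hτ2, hα, GL_map_map, GL_map_map, GL_map_map]
    exact GL_map_congr (fun p => by simp [Polynomial.map_comp, comp_assoc]) σ
  -- Over the localization `β₁ = 1` and `β₂ = α`; over `A` these equalities hold after evaluation at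
  -- suitable multiples.
  obtain ⟨t₁, ht₁, h7⟩ := exists_map_eval_eq M (by rw [h3, map_one]) hβ₁
  obtain ⟨t₂, ht₂, h8⟩ := exists_map_eval_eq M (h4.trans hα0.symm) hβ₂
  refine ⟨(s * (t₁ * t₂)) ^ (N + 1), pow_mem (mul_mem hsM (mul_mem ht₁ ht₂)) _, ?_⟩
  have h9 := HC.map_mem_relElemSymplectic (evalRingHom (t₁ * t₂)) (J := I) (fun a ha => ?_) h2
  · rw [map_mul, map_inv, h7 _ (dvd_mul_right _ _), h8 _ (dvd_mul_left _ _), map_one, inv_one,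
      mul_one, hα, GL_map_map] at h9
    have e0 : (φ.map (C : A →+* A[X])).map (evalRingHom (t₁ * t₂)) = φ := by ext; simp
    rw [e0] at h9
    convert h9 using 1
    exact GL_map_congr (fun p => by simp [eval_comp]) σ
  · suffices I.map (C : A →+* A[X]) ≤ I.comap (evalRingHom (t₁ * t₂)) from this ha
    rw [Ideal.map_le_iff_le_comap]
    intro a ha
    simpa using ha

end Dilation

/-! ### Existence of an orthogonal hyperbolic pair over a local ring. -/

section LocalRing

/-- Project the basis vectors off the plane of `e` and `w`. If no two projections pair to a unit,
nondegeneracy makes all projections vanish in the residue field, so `e` and `w` span a space of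
dimension `m + 1 ≥ 3`. -/
theorem IsSymplecticForm.hasOrthogonalPair {L : Type*} [CommRing L] [IsLocalRing L] {m : ℕ}
    (hm : 2 ≤ m) {φ : Matrix (Fin (m + 1)) (Fin (m + 1)) L} (H : IsSymplecticForm φ) :
    HasOrthogonalPair φ := by
  set B := toBilin' φ with hB
  set e := axisVec φ false with he
  set w := axisVec φ true with hw
  have hP := H.hyperbolic
  rw [← hB, ← he, ← hw] at hP
  set p : Fin (m + 1) → Fin (m + 1) → L := fun i =>
    Pi.single i 1 - B w (Pi.single i 1) • e + B e (Pi.single i 1) • w with hp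
  have hpe : ∀ i, B e (p i) = 0 := fun i => by simp [hp, hP.left_left, hP.left_right]
  have hpw : ∀ i, B w (p i) = 0 := fun i => by simp [hp, hP.right_right, hP.right_left]
  have hp0 : ∀ i, p i 0 = 0 := fun i => by
    have := hpw i
    rwa [hw, axisVec, cond_true, H.toBilin'_dual] at this
  have hφ0 : ∀ i, (φ *ᵥ p i) 0 = 0 := fun i => by
    have := hpe i
    rwa [he, axisVec, cond_false, hB, toBilin'_apply', apply_single] at this
  by_cases hu : ∃ i j, IsUnit (B (p i) (p j))
  · obtain ⟨i, j, u, hu⟩ := hu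
    refine ⟨p i, (↑u⁻¹ : L) • p j, hp0 i, by simp [hp0], hφ0 i, by simp [mulVec_smul, hφ0], ?_⟩
    rw [← toBilin'_apply', map_smul, ← hB, ← hu, smul_eq_mul, Units.inv_mul]
  · push Not at hu
    exfalso
    have h1 : ∀ i x, B (p i) x ∈ IsLocalRing.maximalIdeal L := by
      intro i x
      have hs : ∀ j, B (p i) (Pi.single j 1) = B (p i) (p j) := fun j => by
        have e1 : B (p i) e = 0 := by rw [← hP.alt.neg_eq, hpe, neg_zero]
        have e2 : B (p i) w = 0 := by rw [← hP.alt.neg_eq, hpw, neg_zero]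
        have hpj : p j = Pi.single j 1 - B w (Pi.single j 1) • e + B e (Pi.single j 1) • w := rfl
        rw [hpj]
        generalize p i = y at e1 e2
        simp [e1, e2]
      have hx : x = ∑ j, x j • (Pi.single j 1 : Fin (m + 1) → L) := by
        ext k; simp [Finset.sum_apply, Pi.single_apply]
      rw [hx, map_sum]
      refine sum_mem fun j _ => ?_
      rw [map_smul, hs]
      exact Ideal.mul_mem_left _ _ ((IsLocalRing.mem_maximalIdeal _).2 (hu i j))
    have h2 : ∀ i k, p i k ∈ IsLocalRing.maximalIdeal L := by
      intro i k
      have := h1 i (φ⁻¹ *ᵥ Pi.single k 1)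
      rw [← hP.alt.neg_eq, hB, H.toBilin'_inv_mulVec] at this
      simpa using this
    set r := IsLocalRing.residue L
    have h3 : (1 : Matrix (Fin (m + 1)) (Fin (m + 1)) (IsLocalRing.ResidueField L)) =
        (Matrix.of fun i => ![r (B w (Pi.single i 1)), r (-B e (Pi.single i 1))]) *
          Matrix.of ![r ∘ e, r ∘ w] := by
      ext i k
      have h4 : r (p i k) = 0 := (IsLocalRing.residue_eq_zero_iff _).2 (h2 i k)
      simp only [hp, Pi.add_apply, Pi.sub_apply, Pi.smul_apply, smul_eq_mul, map_add, map_sub,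
        map_mul] at h4
      have h5 : r ((Pi.single i 1 : Fin (m + 1) → L) k) =
          (1 : Matrix (Fin (m + 1)) (Fin (m + 1)) (IsLocalRing.ResidueField L)) i k := by
        rw [Matrix.one_apply, Pi.single_apply]
        by_cases hik : k = i
        · simp [hik]
        · simp [hik, Ne.symm hik]
      rw [h5] at h4
      simp [Matrix.mul_apply, Fin.sum_univ_two]
      linear_combination h4
    have h4 := (Matrix.rank_mul_le_left (Matrix.of fun i : Fin (m + 1) =>
      ![r (B w (Pi.single i 1)), r (-B e (Pi.single i 1))])
      (Matrix.of ![r ∘ e, r ∘ w])).trans (Matrix.rank_le_width _)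
    rw [← h3, Matrix.rank_one, Fintype.card_fin] at h4
    omega

end LocalRing

/-! ### From local to global by Quillen patching. -/

section Patching

/-- The substitution `X ↦ X + s Y`. -/
noncomputable def translateHom {R : Type*} [CommRing R] (s : R) : R[X] →+* R[X][X] :=
  eval₂RingHom ((C : R[X] →+* R[X][X]).comp C) (C X + C (C s) * X)

variable {R : Type*} [CommRing R] {m : ℕ}

/-- Dilation applied to `θ(x + yT) θ(x)⁻¹`, which is `1` at `T = 0`; over `B`, both factors are
substitution instances of the local hypothesis on `θ`. -/
theorem IsSymplecticForm.exists_eval₂_mem {φ : Matrix (Fin (m + 1)) (Fin (m + 1)) R}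
    (H : IsSymplecticForm φ) (I : Ideal R) (θ : GL (Fin (m + 1)) R[X])
    {L : Type*} [CommRing L] [Algebra R L] (hq : HasOrthogonalPair (φ.map (algebraMap R L)))
    (hθ : Matrix.GeneralLinearGroup.map (Polynomial.mapRingHom (algebraMap R L)) θ ∈
      relElemSymplectic ((φ.map (algebraMap R L)).map (C : L →+* L[X]))
        ((I.map (algebraMap R L)).map (C : L →+* L[X])))
    {A B : Type*} [CommRing A] [CommRing B] [Algebra A B] (M : Submonoid A) [IsLocalization M B]
    (f : R →+* A) (g : L →+* B) (hfg : ∀ a, algebraMap A B (f a) = g (algebraMap R L a))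
    (x y : A) :
    ∃ s ∈ M, Matrix.GeneralLinearGroup.map (eval₂RingHom f (x + y * s)) θ *
      (Matrix.GeneralLinearGroup.map (eval₂RingHom f x) θ)⁻¹ ∈
        relElemSymplectic (φ.map f) (I.map f) := by
  have HL := (H.map (algebraMap R L)).map (C : L →+* L[X])
  have e1 : (φ.map f).map (algebraMap A B) = (φ.map (algebraMap R L)).map g := by
    ext1 i j; simp [hfg]
  set σ : GL (Fin (m + 1)) A[X] :=
    Matrix.GeneralLinearGroup.map (eval₂RingHom (C.comp f) (C x + C y * X)) θ *
    (Matrix.GeneralLinearGroup.map (eval₂RingHom (C.comp f) (C x)) θ)⁻¹ with hσ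
  have hgen : ∀ p : A[X], Matrix.GeneralLinearGroup.map (mapRingHom (algebraMap A B))
      (Matrix.GeneralLinearGroup.map (eval₂RingHom (C.comp f) p) θ) ∈ relElemSymplectic
        (((φ.map f).map (algebraMap A B)).map (C : B →+* B[X]))
        (((I.map f).map (algebraMap A B)).map (C : B →+* B[X])) := by
    intro p
    have h1 := HL.map_mem_relElemSymplectic
      (eval₂RingHom (C.comp g) (p.map (algebraMap A B)))
      (J := ((I.map f).map (algebraMap A B)).map (C : B →+* B[X])) (fun a ha => ?_) hθ
    · have e2 : ((φ.map (algebraMap R L)).map (C : L →+* L[X])).map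
          (eval₂RingHom (C.comp g) (p.map (algebraMap A B))) =
          ((φ.map f).map (algebraMap A B)).map (C : B →+* B[X]) := by
        rw [e1]; ext1 i j; simp
      rw [GL_map_map, e2] at h1
      rw [GL_map_map]
      convert h1 using 2
      refine congrArg _ (Polynomial.ringHom_ext (fun a => ?_) ?_) <;> simp [hfg]
    · rw [Ideal.map_map] at ha
      suffices I.map ((C : L →+* L[X]).comp (algebraMap R L)) ≤
        (((I.map f).map (algebraMap A B)).map (C : B →+* B[X])).comap
          (eval₂RingHom (C.comp g) (p.map (algebraMap A B))) from this ha
      rw [Ideal.map_le_iff_le_comap]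
      intro a ha
      have := Ideal.mem_map_of_mem (C : B →+* B[X])
        (Ideal.mem_map_of_mem (algebraMap A B) (Ideal.mem_map_of_mem f ha))
      simpa [Ideal.mem_comap, hfg] using this
  have hσL : Matrix.GeneralLinearGroup.map (mapRingHom (algebraMap A B)) σ ∈ relElemSymplectic
        (((φ.map f).map (algebraMap A B)).map (C : B →+* B[X]))
        (((I.map f).map (algebraMap A B)).map (C : B →+* B[X])) := by
    rw [hσ, map_mul, map_inv]
    exact mul_mem (hgen _) (inv_mem (hgen _))
  have heval : ∀ s, Matrix.GeneralLinearGroup.map (evalRingHom s) σ =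
      Matrix.GeneralLinearGroup.map (eval₂RingHom f (x + y * s)) θ *
      (Matrix.GeneralLinearGroup.map (eval₂RingHom f x) θ)⁻¹ := by
    intro s
    have e3 : (evalRingHom s).comp (eval₂RingHom (C.comp f) (C x + C y * X)) =
        eval₂RingHom f (x + y * s) := by
      refine Polynomial.ringHom_ext (fun a => ?_) ?_ <;> simp
    have e4 : (evalRingHom s).comp (eval₂RingHom (C.comp f) (C x)) = eval₂RingHom f x := by
      refine Polynomial.ringHom_ext (fun a => ?_) ?_ <;> simp
    rw [hσ, map_mul, map_inv, GL_map_map, GL_map_map, e3, e4]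
  have hq' : HasOrthogonalPair ((φ.map f).map (algebraMap A B)) := by
    rw [e1]
    exact hq.map _
  obtain ⟨s, hs, h⟩ := (H.map f).exists_eval_mem M hq' _
    (by rw [heval, mul_zero, add_zero, mul_inv_cancel]) hσL
  exact ⟨s, hs, heval s ▸ h⟩

theorem IsSymplecticForm.exists_translate_mem {φ : Matrix (Fin (m + 1)) (Fin (m + 1)) R}
    (H : IsSymplecticForm φ) (I : Ideal R) (θ : GL (Fin (m + 1)) R[X])
    (M : Submonoid R) {L : Type*} [CommRing L] [Algebra R L] [IsLocalization M L]
    (hq : HasOrthogonalPair (φ.map (algebraMap R L)))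
    (hθ : Matrix.GeneralLinearGroup.map (Polynomial.mapRingHom (algebraMap R L)) θ ∈
      relElemSymplectic ((φ.map (algebraMap R L)).map (C : L →+* L[X]))
        ((I.map (algebraMap R L)).map (C : L →+* L[X]))) :
    ∃ s ∈ M, Matrix.GeneralLinearGroup.map (translateHom s) θ *
      (Matrix.GeneralLinearGroup.map (C : R[X] →+* R[X][X]) θ)⁻¹ ∈
        relElemSymplectic (φ.map ((C : R[X] →+* R[X][X]).comp C))
          (I.map ((C : R[X] →+* R[X][X]).comp C)) := by
  let _ : Algebra R[X] L[X] := Polynomial.algebra R L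
  have : IsLocalization (M.map (C : R →+* R[X])) L[X] := Polynomial.isLocalization M L
  let _ : Algebra R[X][X] L[X][X] := Polynomial.algebra R[X] L[X]
  have : IsLocalization ((M.map (C : R →+* R[X])).map (C : R[X] →+* R[X][X])) L[X][X] :=
    Polynomial.isLocalization _ L[X]
  have halg : algebraMap R[X][X] L[X][X] = mapRingHom (mapRingHom (algebraMap R L)) := rfl
  have key := H.exists_eval₂_mem I θ hq hθ (A := R[X][X]) (B := L[X][X])
    ((M.map (C : R →+* R[X])).map (C : R[X] →+* R[X][X])) ((C : R[X] →+* R[X][X]).comp C)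
    ((C : L[X] →+* L[X][X]).comp C) (fun a => by rw [halg]; simp) (C X) X
  obtain ⟨t, ht, h⟩ := key
  obtain ⟨u, hu, rfl⟩ := Submonoid.mem_map.1 ht
  obtain ⟨s, hs, rfl⟩ := Submonoid.mem_map.1 hu
  refine ⟨s, hs, ?_⟩
  have e1 : eval₂RingHom ((C : R[X] →+* R[X][X]).comp C) (C X + X * C (C s)) = translateHom s := by
    rw [translateHom, mul_comm X]
  have e2 : eval₂RingHom ((C : R[X] →+* R[X][X]).comp C) (C X) = (C : R[X] →+* R[X][X]) := by
    refine Polynomial.ringHom_ext (fun a => ?_) ?_ <;> simp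
  rw [e1, e2] at h
  exact h

/-- Quillen's patching argument. -/
theorem IsSymplecticForm.mem_of_forall_translate {φ : Matrix (Fin (m + 1)) (Fin (m + 1)) R}
    (H : IsSymplecticForm φ) (I : Ideal R) (θ : GL (Fin (m + 1)) R[X])
    (hθ0 : Matrix.GeneralLinearGroup.map (evalRingHom (0 : R)) θ = 1)
    (h : ∀ (𝔪 : Ideal R) [𝔪.IsMaximal], ∃ s ∉ 𝔪,
      Matrix.GeneralLinearGroup.map (translateHom s) θ *
      (Matrix.GeneralLinearGroup.map (C : R[X] →+* R[X][X]) θ)⁻¹ ∈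
        relElemSymplectic (φ.map ((C : R[X] →+* R[X][X]).comp C))
          (I.map ((C : R[X] →+* R[X][X]).comp C))) :
    θ ∈ relElemSymplectic (φ.map (C : R →+* R[X])) (I.map (C : R →+* R[X])) := by
  have HCC := H.map ((C : R[X] →+* R[X][X]).comp C)
  have hsub : ∀ f : R[X][X] →+* R[X][X], (∀ a : R, f (C (C a)) = C (C a)) →
      ∀ g ∈ relElemSymplectic (φ.map ((C : R[X] →+* R[X][X]).comp C))
        (I.map ((C : R[X] →+* R[X][X]).comp C)),
      Matrix.GeneralLinearGroup.map f g ∈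
        relElemSymplectic (φ.map ((C : R[X] →+* R[X][X]).comp C))
        (I.map ((C : R[X] →+* R[X][X]).comp C)) := by
    intro f hf g hg
    have hφ : (φ.map ((C : R[X] →+* R[X][X]).comp C)).map f =
        φ.map ((C : R[X] →+* R[X][X]).comp C) := by ext1 i j; simp [hf]
    rw [← hφ]
    refine HCC.map_mem_relElemSymplectic f (fun a ha => ?_) hg
    suffices I.map ((C : R[X] →+* R[X][X]).comp C) ≤
      (I.map ((C : R[X] →+* R[X][X]).comp C)).comap f from this ha
    rw [Ideal.map_le_iff_le_comap]
    intro a ha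
    have := Ideal.mem_map_of_mem ((C : R[X] →+* R[X][X]).comp C) ha
    simpa [Ideal.mem_comap, hf] using this
  let Q : Ideal R :=
    { carrier := {s | Matrix.GeneralLinearGroup.map (translateHom s) θ *
        (Matrix.GeneralLinearGroup.map (C : R[X] →+* R[X][X]) θ)⁻¹ ∈
          relElemSymplectic (φ.map ((C : R[X] →+* R[X][X]).comp C))
            (I.map ((C : R[X] →+* R[X][X]).comp C))}
      zero_mem' := by
        have : translateHom (0 : R) = C := by ext <;> simp [translateHom]
        rw [Set.mem_ofPred_eq, this, mul_inv_cancel]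
        exact one_mem _
      add_mem' := by
        intro s t hs ht
        rw [Set.mem_ofPred_eq] at hs ht ⊢
        -- Substituting `X ↦ X + sY` gives `θ(X + (s + t)Y) θ(X + sY)⁻¹`, which telescopes with the
        -- element for `s`.
        have h1 := hsub (eval₂RingHom (translateHom s) X) (fun a => by simp [translateHom]) _ ht
        have e1 : (eval₂RingHom (translateHom s) X).comp (translateHom t) =
            translateHom (s + t) := by
          ext <;> simp [translateHom, add_mul, add_assoc]
        have e2 : (eval₂RingHom (translateHom s) X).comp C = translateHom s := by
          ext <;> simp
        rw [map_mul, map_inv, GL_map_map, GL_map_map, e1, e2] at h1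
        have := mul_mem h1 hs
        rwa [mul_assoc, inv_mul_cancel_left] at this
      smul_mem' := by
        intro c s hs
        rw [Set.mem_ofPred_eq] at hs ⊢
        -- Here the substitution is `Y ↦ cY`.
        have h1 := hsub (compRingHom (C (C c) * X)) (fun a => by simp) _ hs
        have e1 : (compRingHom (C (C c) * X)).comp (translateHom s) = translateHom (c • s) := by
          refine Polynomial.ringHom_ext (fun a => by simp [translateHom]) ?_
          simp [translateHom]
          ring
        have e2 : (compRingHom (C (C c) * X)).comp (C : R[X] →+* R[X][X]) = C := by
          ext <;> simp
        rwa [map_mul, map_inv, GL_map_map, GL_map_map, e1, e2] at h1 }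
  have hQ : Q = ⊤ := by
    by_contra hne
    obtain ⟨𝔪, h𝔪, hle⟩ := Ideal.exists_le_maximal Q hne
    obtain ⟨s, hs, hsQ⟩ := h 𝔪
    exact hs (hle hsQ)
  have h1 : (1 : R) ∈ Q := hQ ▸ Submodule.mem_top
  -- The map `X ↦ 0`, `Y ↦ X` turns `θ(X + Y) θ(X)⁻¹` into `θ(X) θ(0)⁻¹`.
  have h2 := HCC.map_mem_relElemSymplectic
    (eval₂RingHom (C.comp (evalRingHom (0 : R))) X) (J := I.map C) (fun a ha => ?_) h1
  · have e1 : (eval₂RingHom (C.comp (evalRingHom (0 : R))) X).comp (translateHom (1 : R)) =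
        RingHom.id _ := by ext <;> simp [translateHom]
    have e2 : (eval₂RingHom (C.comp (evalRingHom (0 : R))) X).comp C =
        C.comp (evalRingHom (0 : R)) := by ext <;> simp
    have e3 : (φ.map ((C : R[X] →+* R[X][X]).comp C)).map
        (eval₂RingHom (C.comp (evalRingHom (0 : R))) X) = φ.map (C : R →+* R[X]) := by
      ext1 i j; simp
    rw [map_mul, map_inv, GL_map_map, GL_map_map, e1, e2, ← GL_map_map, hθ0, map_one, inv_one,
      mul_one, e3] at h2
    convert h2 using 1
    ext; simp
  · suffices I.map ((C : R[X] →+* R[X][X]).comp C) ≤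
      (I.map (C : R →+* R[X])).comap (eval₂RingHom (C.comp (evalRingHom (0 : R))) X) from this ha
    rw [Ideal.map_le_iff_le_comap]
    intro a ha
    simpa [Ideal.mem_comap] using Ideal.mem_map_of_mem (C : R →+* R[X]) ha

end Patching

/-! ### The local-global principle. -/

theorem mainTheorem3 {R : Type*} [CommRing R] (h2 : IsUnit (2 : R)) (I : Ideal R)
    (n m : ℕ) (hn : 2 ≤ n) (hm : m + 1 = 2 * n)
    (φ : Matrix (Fin (m + 1)) (Fin (m + 1)) R) (hskew : φᵀ = -φ)
    (hpf : pfaffian (m + 1) φ = 1)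
    (θ : GL (Fin (m + 1)) R[X])
    (hθ : θ ∈ symplecticGroupOf (φ.map (C : R →+* R[X])))
    (hθ0 : Matrix.GeneralLinearGroup.map (Polynomial.evalRingHom (0 : R)) θ = 1)
    (hloc : ∀ (𝔪 : Ideal R) [𝔪.IsMaximal],
      Matrix.GeneralLinearGroup.map
          (Polynomial.mapRingHom (algebraMap R (Localization.AtPrime 𝔪))) θ ∈
        relElemSymplectic
          ((φ.map (algebraMap R (Localization.AtPrime 𝔪))).map
            (C : Localization.AtPrime 𝔪 →+* (Localization.AtPrime 𝔪)[X]))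
          ((I.map (algebraMap R (Localization.AtPrime 𝔪))).map
            (C : Localization.AtPrime 𝔪 →+* (Localization.AtPrime 𝔪)[X]))) :
    θ ∈ relElemSymplectic (φ.map (C : R →+* R[X])) (I.map (C : R →+* R[X])) := by
  have H : IsSymplecticForm φ := ⟨hskew, isUnit_det_of_pfaffian φ h2 hskew hpf, h2⟩
  refine H.mem_of_forall_translate I θ hθ0 fun 𝔪 _ => ?_
  have hq := (H.map (algebraMap R (Localization.AtPrime 𝔪))).hasOrthogonalPair (by omega)
  exact H.exists_translate_mem I θ 𝔪.primeCompl hq (hloc 𝔪)
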